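/- **Setting.** Let $u=u_{x,y}\in\mathcal O_c'$ be a generalized kernel, i.e. a continuous linear functional on the space $\mathcal O_C(\mathbb C\times\mathbb C)$ of very slowly increasing smooth functions of two complex variables (kernels in real variables are those supported on $\mathbb R^2$), with bilinear form $\langle P(x),Q(y)\rangle_u=\langle u_{x,y},P(x)\otimes Q(y)\rangle$ on $\mathbb C[x]$. Let $\operatorname{supp}_y(u)$ be the smallest closed $F\subseteq\mathbb C$ such that $u$ vanishes on functions supported in $\mathbb C\times(\mathbb C\setminus F)$. If $R$ is a rational function whose poles are off $\operatorname{supp}_y(u)$, then $\langle P(x),R(y)\rangle_u$ is the value of $u$ at any test function equal to $P(x)R(y)$ for all $y$ outside a compact set disjoint from $\operatorname{supp}_y(u)$. Let $W(y)=\prod_{i=1}^d(y-q_i)^{m_i}$ with $d\ge1$, distinct $q_i\in\mathbb C\setminus\operatorname{supp}_y(u)$, $m_i\ge 1$, and put $N=\sum_i m_i$. Let $\check u$ be a bilinear form on polynomials (an element of $(\mathbb C[x,y])'$), and assume that $u$ and $\check u$ are quasi-definite, i.e. all leading principal minors of their Gram matrices $G=(\langle x^k,y^l\rangle_u)$, $\check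 G$ are nonzero. Let $G=S_1^{-1}HS_2^{-\top}$ and $\check G=\check S_1^{-1}\check H\check S_2^{-\top}$ with $S_i,\check S_i$ lower unitriangular and $H,\check H$ diagonal, and put $P^{[i]}=S_i\chi$, $\check P^{[i]}=\check S_i\chi$, where $\chi(x)=(1,x,x^2,\dots)^\top$. Put $C^{[1]}_n(z)=\big\langle P^{[1]}_n(x),\frac1{z-y}\big\rangle_u$ and $$K_{n-1}(x,y)=\sum_{k=0}^{n-1}P^{[2]}_k(y)H_k^{-1}P^{[1]}_k(x),\qquad K^{(pc)}_{n-1}(x,y)=\sum_{k=0}^{n-1}P^{[2]}_k(y)H_k^{-1}C^{[1]}_k(x).$$ For a function $f$ let $\boldsymbol{\mathcal J}_f\in\mathbb C^{N}$ be the row with entries $\frac{f^{(l)}(q_i)}{l!}$, $1\le i\le d$, $0\le l<m_i$, ordered by $i$ and then by $l$; for a function of $(x,y)$ the jet $\boldsymbol{\mathcal J}_f(y)$ is taken in $x$. Let $\mathcal V(x,y)=\frac{W(x)-W(y)}{x-y}=\sum_k w_k\sum_{i+j=k-1}x^iy^j$, where $W=\sum_k w_ky^k$, and let $\mathcal W\in\mathbb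 C^{N\times N}$ be the block diagonal matrix whose $i$-th block is the $m_i\times m_i$ upper triangular Toeplitz matrix with entries $\frac{W^{(m_i+b-a)}(q_i)}{(m_i+b-a)!}$, $0\le a,b<m_i$ (these are $0$ for $b<a$). For linear functionals $\xi_{i,l}$ on $\mathbb C[x]$ ($1\le i\le d$, $0\le l<m_i$) let $\langle P(x),(\xi)_x\rangle\in\mathbb C^N$ be the row whose $i$-th block is $(\langle\xi_{i,m_i-1},P\rangle,\dots,\langle\xi_{i,0},P\rangle)$. Finally, $\Theta_*$ denotes the quasi-determinant with respect to the last entry: $\Theta_*\begin{pmatrix}A&B\\C&D\end{pmatrix}=D-CA^{-1}B$ with $D$ a scalar and $A$ nonsingular. **Statement.** 1. $\check u$ is a Geronimus transformation of $u$, $\check u_{x,y}W(y)=u_{x,y}$ (that is, $\langle P,QW\rangle_{\check u}=\langle P,Q\rangle_u$ for all polynomials $P,Q$), if and only if there are linear functionals $\xi_{i,l}$ on $\mathbb C[x]$ with $$\check u_{x,y}=\frac{u_{x,y}}{W(y)}+\sum_{i=1}^d\sum_{l=0}^{m_i-1}\frac{(-1)^l}{l!}(\xi_{i,l})_x\otimes\delta^{(l)}(y-q_i),\qquad(\ast)$$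 i.e. $\langle P,Q\rangle_{\check u}=\big\langle P,\tfrac{Q}{W}\big\rangle_u+\sum_{i,l}\langle\xi_{i,l},P\rangle\frac{Q^{(l)}(q_i)}{l!}$ for all polynomials $P,Q$. 2. Every $C^{[1]}_k$ is analytic at every $q_i$. 3. For all functionals $\xi_{i,l}$ for which $(\ast)$ holds and all $n\ge N$, the $N\times N$ matrix with rows $\boldsymbol{\mathcal J}_{C^{[1]}_{k}}-\langle P^{[1]}_{k}(x),(\xi)_x\rangle\mathcal W$, $k=n-N,\dots,n-1$, is nonsingular, and for all $x,y\in\mathbb C$ $$\check P^{[1]}_{n}(x)=\Theta_*\begin{pmatrix}\boldsymbol{\mathcal J}_{C^{[1]}_{n-N}}-\langle P^{[1]}_{n-N}(x),(\xi)_x\rangle\mathcal W& P_{n-N}^{[1]}(x)\\ \vdots&\vdots\\ \boldsymbol{\mathcal J}_{C^{[1]}_{n}}-\langle P^{[1]}_{n}(x),(\xi)_x\rangle\mathcal W& P^{[1]}_n(x)\end{pmatrix},$$ $$\check H_{n}=\Theta_*\begin{pmatrix}\boldsymbol{\mathcal J}_{C^{[1]}_{n-N}}-\langle P^{[1]}_{n-N}(x),(\xi)_x\rangle\mathcal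 W& H_{n-N}\\ \boldsymbol{\mathcal J}_{C^{[1]}_{n-N+1}}-\langle P^{[1]}_{n-N+1}(x),(\xi)_x\rangle\mathcal W& 0\\ \vdots&\vdots\\ \boldsymbol{\mathcal J}_{C^{[1]}_{n}}-\langle P^{[1]}_{n}(x),(\xi)_x\rangle\mathcal W& 0\end{pmatrix},$$ $$\check P_{n}^{[2]}(y)=-\Theta_*\begin{pmatrix}\boldsymbol{\mathcal J}_{C^{[1]}_{n-N}}-\langle P^{[1]}_{n-N}(x),(\xi)_x\rangle\mathcal W& H_{n-N}\\ \boldsymbol{\mathcal J}_{C^{[1]}_{n-N+1}}-\langle P^{[1]}_{n-N+1}(x),(\xi)_x\rangle\mathcal W& 0\\ \vdots&\vdots\\ \boldsymbol{\mathcal J}_{C^{[1]}_{n-1}}-\langle P^{[1]}_{n-1}(x),(\xi)_x\rangle\mathcal W&0\\ W(y)\big(\boldsymbol{\mathcal J}_{K^{(pc)}_{n-1}}(y)-\langle K_{n-1}(x,y),(\xi)_x\rangle\mathcal W\big)+\boldsymbol{\mathcal J}_{\mathcal V}(y)&0\end{pmatrix}.$$ -/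

import Mathlib

open scoped ContDiff Polynomial Nat

noncomputable section

/-- The very slowly increasing functions on `ℂ × ℂ` (the space `𝓞_C`): the complex-valued
functions which are smooth in the real sense and for which one polynomial weight, the same for the
derivatives of all orders, bounds every derivative. -/
def slowlyIncreasing : Subalgebra ℂ (ℂ × ℂ → ℂ) where
  carrier := {f | ContDiff ℝ ∞ f ∧
    ∃ k : ℕ, ∀ n : ℕ, ∃ C : ℝ, ∀ p, ‖iteratedFDeriv ℝ n f p‖ ≤ C * (1 + ‖p‖) ^ k}
  mul_mem' := by
    rintro f g ⟨hf, k, hk⟩ ⟨hg, l, hl⟩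
    choose A hA using hk
    choose B hB using hl
    refine ⟨hf.mul hg, k + l, fun n => ⟨∑ i ∈ Finset.range (n + 1),
      (n.choose i : ℝ) * A i * B (n - i), fun p => ?_⟩⟩
    refine (norm_iteratedFDeriv_mul_le hf hg p (n := n) (mod_cast le_top)).trans ?_
    rw [Finset.sum_mul]
    refine Finset.sum_le_sum fun i _ => ?_
    calc (n.choose i : ℝ) * ‖iteratedFDeriv ℝ i f p‖ * ‖iteratedFDeriv ℝ (n - i) g p‖
        = (n.choose i : ℝ) * (‖iteratedFDeriv ℝ i f p‖ * ‖iteratedFDeriv ℝ (n - i) g p‖) := by ring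
      _ ≤ (n.choose i : ℝ) * ((A i * (1 + ‖p‖) ^ k) * (B (n - i) * (1 + ‖p‖) ^ l)) := by
        refine mul_le_mul_of_nonneg_left ?_ (Nat.cast_nonneg _)
        exact mul_le_mul (hA i p) (hB (n - i) p) (norm_nonneg _) ((norm_nonneg _).trans (hA i p))
      _ = _ := by ring
  add_mem' := by
    rintro f g ⟨hf, k, hk⟩ ⟨hg, l, hl⟩
    choose A hA using hk
    choose B hB using hl
    refine ⟨hf.add hg, k + l, fun n => ⟨|A n| + |B n|, fun p => ?_⟩⟩
    have h1 : (1 : ℝ) ≤ 1 + ‖p‖ := le_add_of_nonneg_right (norm_nonneg p)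
    rw [iteratedFDeriv_add (hf.of_le (mod_cast le_top)) (hg.of_le (mod_cast le_top)), add_mul]
    refine (norm_add_le _ _).trans (add_le_add ?_ ?_)
    · refine (hA n p).trans (mul_le_mul (le_abs_self _) ?_ (by positivity) (abs_nonneg _))
      exact pow_le_pow_right₀ h1 (Nat.le_add_right _ _)
    · refine (hB n p).trans (mul_le_mul (le_abs_self _) ?_ (by positivity) (abs_nonneg _))
      exact pow_le_pow_right₀ h1 (Nat.le_add_left _ _)
  algebraMap_mem' := by
    intro c
    refine ⟨contDiff_const, 0, fun n => ⟨‖c‖, fun p => ?_⟩⟩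
    have h : (algebraMap ℂ (ℂ × ℂ → ℂ) c) = fun _ => c := rfl
    rw [h]
    rcases Nat.eq_zero_or_pos n with rfl | hn
    · simp
    · rw [iteratedFDeriv_const_of_ne hn.ne']
      simp

/-- Continuous real-linear functions are very slowly increasing. -/
theorem clm_mem_slowlyIncreasing (L : ℂ × ℂ →L[ℝ] ℂ) : (L : ℂ × ℂ → ℂ) ∈ slowlyIncreasing := by
  refine ⟨L.contDiff, 1, fun n => ⟨‖L‖, fun p => ?_⟩⟩
  have h0 := norm_nonneg p
  have hL := norm_nonneg L
  match n with
  | 0 =>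
    rw [norm_iteratedFDeriv_zero, pow_one]
    refine (L.le_opNorm p).trans (mul_le_mul_of_nonneg_left (by linarith) hL)
  | 1 =>
    rw [← norm_iteratedFDeriv_fderiv, norm_iteratedFDeriv_zero, L.fderiv, pow_one]
    nlinarith
  | n + 2 =>
    rw [← norm_iteratedFDeriv_fderiv]
    have h : fderiv ℝ (L : ℂ × ℂ → ℂ) = fun _ => L := by ext1 x; exact L.fderiv
    rw [h, iteratedFDeriv_const_of_ne (Nat.succ_ne_zero n)]
    simp only [Pi.zero_apply, norm_zero]
    positivity

/-- The coordinate functions `x` and `y`. -/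
def coordX : slowlyIncreasing := ⟨Prod.fst, clm_mem_slowlyIncreasing (.fst ℝ ℂ ℂ)⟩

def coordY : slowlyIncreasing := ⟨Prod.snd, clm_mem_slowlyIncreasing (.snd ℝ ℂ ℂ)⟩

/-- A generalized kernel `u_{x,y}`, i.e. an element of `𝓞_C'`: a linear functional on the very
slowly increasing functions that is continuous on each of the weighted Fréchet spaces whose
inductive limit `𝓞_C` is. -/
structure GeneralizedKernel where
  toFun : slowlyIncreasing →ₗ[ℂ] ℂ
  continuous' : ∀ k : ℕ, ∃ (m : ℕ) (C : ℝ), ∀ (f : slowlyIncreasing) (A : ℝ),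
    (∀ j ≤ m, ∀ p, ‖iteratedFDeriv ℝ j (f : ℂ × ℂ → ℂ) p‖ ≤ A * (1 + ‖p‖) ^ k) →
      ‖toFun f‖ ≤ C * A

namespace GeneralizedKernel

/-- The bilinear form `⟨P(x), Q(y)⟩_u = ⟨u_{x,y}, P(x) ⊗ Q(y)⟩` on polynomials. -/
def form (u : GeneralizedKernel) : LinearMap.BilinForm ℂ ℂ[X] :=
  ((LinearMap.mul ℂ slowlyIncreasing).compl₁₂ (Polynomial.aeval coordX).toLinearMap
    (Polynomial.aeval coordY).toLinearMap).compr₂ u.toFun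

/-- `supp_y(u)`: the smallest closed `F ⊆ ℂ` such that `u` vanishes on the functions supported in
`ℂ × (ℂ ∖ F)`. -/
def suppY (u : GeneralizedKernel) : Set ℂ :=
  ⋂₀ {F | IsClosed F ∧ ∀ f : slowlyIncreasing,
    (∀ p ∈ tsupport (f : ℂ × ℂ → ℂ), p.2 ∉ F) → u.toFun f = 0}

/-- `g` is a test function that coincides with `P(x) R(y)` for all `y` outside a compact set
disjoint from `supp_y(u)`. -/
def IsExtension (u : GeneralizedKernel) (P : ℂ[X]) (R : ℂ → ℂ) (g : slowlyIncreasing) : Prop :=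
  ∃ K : Set ℂ, IsCompact K ∧ Disjoint K u.suppY ∧
    ∀ x y : ℂ, y ∉ K → (g : ℂ × ℂ → ℂ) (x, y) = P.eval x * R y

open Classical in
/-- `⟨P(x), R(y)⟩_u` for a function `R` with singularities off `supp_y(u)` (such as a rational
function): the value of `u` at any test function that agrees with `P(x) R(y)` off a compact set of
`y`'s disjoint from `supp_y(u)`; it does not depend on the choice. -/
def pair (u : GeneralizedKernel) (P : ℂ[X]) (R : ℂ → ℂ) : ℂ :=
  if h : ∃ g, u.IsExtension P R g then u.toFun h.choose else 0

/-- The second kind function `C(z) = ⟨P(x), 1 / (z - y)⟩_u` attached to `P`. -/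
def secondKind (u : GeneralizedKernel) (P : ℂ[X]) (z : ℂ) : ℂ :=
  u.pair P fun y => 1 / (z - y)

end GeneralizedKernel

/-- All leading principal minors of the Gram matrix `⟨x^i, y^j⟩` are nonzero. -/
def QuasiDefinite (B : LinearMap.BilinForm ℂ ℂ[X]) : Prop :=
  ∀ n : ℕ, (Matrix.of fun i j : Fin n =>
    B (Polynomial.X ^ (i : ℕ)) (Polynomial.X ^ (j : ℕ))).det ≠ 0

/-- A semi-infinite lower unitriangular matrix. -/
structure LowerUnitriangular (S : Matrix ℕ ℕ ℂ) : Prop where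
  upper : ∀ i j, i < j → S i j = 0
  diag : ∀ i, S i i = 1

/-- The Gauss--Borel factorization `G = S₁⁻¹ H S₂⁻ᵀ` of the Gram matrix `G` of `B`, written as
`S₁ G S₂ᵀ = H`, with `S₁`, `S₂` lower unitriangular and `H` diagonal. -/
structure IsGaussBorel (B : LinearMap.BilinForm ℂ ℂ[X]) (S₁ S₂ : Matrix ℕ ℕ ℂ) (H : ℕ → ℂ) :
    Prop where
  lower₁ : LowerUnitriangular S₁
  lower₂ : LowerUnitriangular S₂
  factor : ∀ k l : ℕ, (∑ i ∈ Finset.range (k + 1), ∑ j ∈ Finset.range (l + 1),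
    S₁ k i * B (Polynomial.X ^ i) (Polynomial.X ^ j) * S₂ l j) = if k = l then H k else 0

/-- The `n`-th entry of `S χ(x)`, `χ(x) = (1, x, x², …)ᵀ`. -/
def polyOf (S : Matrix ℕ ℕ ℂ) (n : ℕ) : ℂ[X] :=
  ∑ k ∈ Finset.range (n + 1), Polynomial.C (S n k) * Polynomial.X ^ k

/-- The Christoffel--Darboux kernel `∑_{k < n} P_{2,k}(y) H_k⁻¹ P_{1,k}(x)` (that is, `K_{n-1}`), as
a polynomial in `x` for fixed `y`. -/
def cdKernel (S₁ S₂ : Matrix ℕ ℕ ℂ) (H : ℕ → ℂ) (n : ℕ) (y : ℂ) : ℂ[X] :=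
  ∑ k ∈ Finset.range n, Polynomial.C ((polyOf S₂ k).eval y * (H k)⁻¹) * polyOf S₁ k

/-- The mixed Christoffel--Darboux kernel `∑_{k < n} P_{2,k}(y) H_k⁻¹ C_{1,k}(x)`
(that is, `K^{mix}_{n-1}(x, y)`). -/
def mixedKernel (u : GeneralizedKernel) (S₁ S₂ : Matrix ℕ ℕ ℂ) (H : ℕ → ℂ) (n : ℕ) (x y : ℂ) : ℂ :=
  ∑ k ∈ Finset.range n, (polyOf S₂ k).eval y * (H k)⁻¹ * u.secondKind (polyOf S₁ k) x

/-- The quasi-determinant of a matrix with respect to its last entry: the Schur complement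
`D - C A⁻¹ B` of the upper left block `A`. -/
def thetaStar {N : ℕ} (M : Matrix (Fin (N + 1)) (Fin (N + 1)) ℂ) : ℂ :=
  M (Fin.last N) (Fin.last N) - ∑ i : Fin N, ∑ j : Fin N,
    M (Fin.last N) i.castSucc * (M.submatrix Fin.castSucc Fin.castSucc)⁻¹ i j *
      M j.castSucc (Fin.last N)

section Perturbation

variable {d : ℕ} (q : Fin d → ℂ) (m : Fin d → ℕ)

/-- The perturbing polynomial `W = ∏ i, (y - q_i) ^ m_i`, of degree `∑ i, m i`. -/
def pertPoly : ℂ[X] := ∏ i, (Polynomial.X - Polynomial.C (q i)) ^ m i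

/-- The jet of `f`: the row of the `f^{(l)}(q_i) / l!`, `l < m_i`, ordered by `i`, then by `l`. -/
def jet (f : ℂ → ℂ) (c : Fin (∑ i, m i)) : ℂ :=
  let s := finSigmaFinEquiv.symm c
  iteratedDeriv s.2 f (q s.1) / ((s.2 : ℕ) ! : ℂ)

variable {m} in
/-- The row `⟨P(x), ξ_x⟩` of the values at `P` of the functionals, in the order
`ξ_{i, m_i - 1}, …, ξ_{i, 0}` within the `i`-th block. -/
def massRow (ξ : (i : Fin d) → Fin (m i) → ℂ[X] →ₗ[ℂ] ℂ) (P : ℂ[X]) (c : Fin (∑ i, m i)) : ℂ :=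
  let s := finSigmaFinEquiv.symm c
  ξ s.1 s.2.rev P

/-- The block diagonal matrix `𝒲`, whose `i`-th block is the upper triangular Toeplitz matrix with
entries `W^{(m_i + b - a)}(q_i) / (m_i + b - a)!`, `0 ≤ a, b < m_i`. (This is `0` for `b < a`, as
`W` vanishes to order `m_i` at `q_i`.) -/
def massMatrix : Matrix (Fin (∑ i, m i)) (Fin (∑ i, m i)) ℂ :=
  Matrix.of fun c c' =>
    let s := finSigmaFinEquiv.symm c
    let t := finSigmaFinEquiv.symm c'
    if s.1 = t.1 then
      (Polynomial.derivative^[m s.1 + t.2 - s.2] (pertPoly q m)).eval (q s.1) /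
        ((m s.1 + t.2 - s.2) ! : ℂ)
    else 0

/-- `𝒱(x, y) = ∑_k w_k h_{k-1}(x, y)`, with `W = ∑_k w_k y^k` and `h_{k-1}(x, y) =
∑_{i + j = k - 1} x^i y^j` the complete symmetric polynomial; that is, the polynomial
`(W(x) - W(y)) / (x - y)`. -/
def dividedDiff (x y : ℂ) : ℂ :=
  ∑ k ∈ Finset.range (∑ i, m i + 1), (pertPoly q m).coeff k *
    ∑ i ∈ Finset.range k, x ^ i * y ^ (k - 1 - i)

/-- `v W(y) = u`, for a bilinear form `v` on polynomials (an element of `(ℂ[x, y])'`). -/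
def IsGeronimus (u : GeneralizedKernel) (v : LinearMap.BilinForm ℂ ℂ[X]) : Prop :=
  ∀ P Q : ℂ[X], v P (Q * pertPoly q m) = u.form P Q

variable {m} in
/-- `v_{x,y} = u_{x,y} / W(y) + ∑_i ∑_{l < m_i} ((-1)^l / l!) (ξ_{i,l})_x ⊗ δ^{(l)}(y - q_i)`. -/
def HasMasses (u : GeneralizedKernel) (ξ : (i : Fin d) → Fin (m i) → ℂ[X] →ₗ[ℂ] ℂ)
    (v : LinearMap.BilinForm ℂ ℂ[X]) : Prop :=
  ∀ P Q : ℂ[X], v P Q = u.pair P (fun y => Q.eval y / (pertPoly q m).eval y) +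
    ∑ i, ∑ l : Fin (m i),
      ξ i l P * ((Polynomial.derivative^[(l : ℕ)] Q).eval (q i) / ((l : ℕ) ! : ℂ))

variable {m} in
/-- The row `𝒥_{C_k} - ⟨P_k(x), ξ_x⟩ 𝒲`. -/
def corrRow (u : GeneralizedKernel) (ξ : (i : Fin d) → Fin (m i) → ℂ[X] →ₗ[ℂ] ℂ)
    (S₁ : Matrix ℕ ℕ ℂ) (k : ℕ) : Fin (∑ i, m i) → ℂ :=
  jet q m (u.secondKind (polyOf S₁ k)) - Matrix.vecMul (massRow ξ (polyOf S₁ k)) (massMatrix q m)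

variable {m} in
/-- The row `W(y) (𝒥_{K^{mix}_{n-1}}(y) - ⟨K_{n-1}(x, y), ξ_x⟩ 𝒲) + 𝒥_𝒱(y)`, all jets being taken
in the first variable. -/
def kernelRow (u : GeneralizedKernel) (ξ : (i : Fin d) → Fin (m i) → ℂ[X] →ₗ[ℂ] ℂ)
    (S₁ S₂ : Matrix ℕ ℕ ℂ) (H : ℕ → ℂ) (n : ℕ) (y : ℂ) : Fin (∑ i, m i) → ℂ :=
  (pertPoly q m).eval y • (jet q m (fun x => mixedKernel u S₁ S₂ H n x y) -
    Matrix.vecMul (massRow ξ (cdKernel S₁ S₂ H n y)) (massMatrix q m)) +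
  jet q m (fun x => dividedDiff q m x y)

end Perturbation

end

/-!
The proof evaluates everything in terms of the perturbed form `v` and the polynomials
`E_{i,a}(y) = W(y) / (y - q_i)^(a + 1)`, `a < m_i` (`pertQuotient`).

*Pairings.* By compactness `u` vanishes on the test functions supported over a compact set of `y`'s
off `supp_y(u)` (`map_eq_zero_of_isCompact`), so `⟨P, R⟩_u` may be computed with any extension.
With translates of one smooth truncation of `1 / y`, whose derivatives are bounded, the continuity
of `u` makes the geometric series of `1 / (z - y)` converge after pairing. Hence the second kind
functions are analytic off the support, with Taylor coefficients `-⟨P, (y - q)^{-(a + 1)}⟩_u`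
(`exists_inv_extension`).

*Masses.* If `v W = u`, then `v - u / W` vanishes on the multiples of `W`; by Hermite interpolation it
is a combination of the jets at the zeros of `W`, whose coefficients are functionals of `P`
(`isGeronimus_iff_exists_hasMasses`).

*Rows.* As `E_{i,a} / W = (y - q_i)^{-(a + 1)}`, and the jets of `E_{i,a}` are shifted jets of `W`, the
entries of `𝒥_C - ⟨P, ξ⟩ 𝒲` are the numbers `-v(P, E_{i,a})` (`jet_secondKind_sub_massRow`). The jets
in `x` of `(W(x) - W(y)) / (x - y)` are the `E_{i,a}(y)` themselves (`jet_dividedDiff`). By Bézout the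
`E_{i,a}` generate all polynomials modulo `W` (`exists_sub_mul_pertPoly_mem_span`).

*Quasi-determinants.* A combination of the `N` rows that vanishes is a polynomial of degree less than
`n` orthogonal for `v` to all polynomials of degree less than `n`, so that it is zero
(`isUnit_det_corrRow`). The perturbed polynomial `P̌_n` is orthogonal for `u` to degrees less than
`n - N`, so it is a combination of `P_{n-N}, …, P_n`, and it is orthogonal for `v` to the `E_{i,a}`:
this is a linear relation between the rows, and evaluates the first two quasi-determinants
(`exists_connection_first`). For the third one, the polynomial `W(y) K_{n-1}(x, y) - Ǩ_{n-1}(x, y)` in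
`x` is, by the reproducing properties of the two Christoffel--Darboux kernels, a combination of
`P_{n-N}, …, P_{n-1}` (`exists_connection_second`).
-/

/-! ### Test functions depending on `y` only -/

/-- The function `f` on `ℂ` is smooth in the real sense, with bounded derivatives of all orders. -/
def SmoothBounded (f : ℂ → ℂ) : Prop :=
  ContDiff ℝ ∞ f ∧ ∀ n : ℕ, ∃ C : ℝ, ∀ y, ‖iteratedFDeriv ℝ n f y‖ ≤ C

theorem exists_bound_iteratedFDeriv_of_hasCompactSupport {E : Type*} [NormedAddCommGroup E]
    [NormedSpace ℝ E] {f : ℂ → E} (hf : ContDiff ℝ ∞ f) (hc : HasCompactSupport f) (n : ℕ) :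
    ∃ C : ℝ, ∀ y, ‖iteratedFDeriv ℝ n f y‖ ≤ C :=
  (hc.iteratedFDeriv n).exists_bound_of_continuous
    (hf.continuous_iteratedFDeriv (mod_cast le_top))

/-- A smooth function equal to `1 / y` away from a small disc has bounded derivatives: its
derivative is `-f² dy` up to a compactly supported error, so that the Leibniz rule bounds each
derivative in terms of those of lower order. -/
theorem exists_smoothBounded_eq_inv {ε : ℝ} (hε : 0 < ε) :
    ∃ b : ℂ → ℂ, SmoothBounded b ∧ ∀ y, ε ≤ ‖y‖ → b y = y⁻¹ := by
  let χ : ContDiffBump (0 : ℂ) := ⟨ε / 2, ε, by positivity, by linarith⟩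
  let b : ℂ → ℂ := fun y => ((1 - χ y : ℝ) : ℂ) * y⁻¹
  have hb : ContDiff ℝ ∞ b := by
    rw [contDiff_iff_contDiffAt]
    intro y
    by_cases hy : y = 0
    · subst hy
      refine (contDiffAt_const (c := (0 : ℂ))).congr_of_eventuallyEq ?_
      filter_upwards [χ.eventuallyEq_one] with y hy
      simp [b, hy]
    · refine ContDiffAt.mul ?_ ?_
      · exact Complex.ofRealCLM.contDiff.contDiffAt.comp y
          (contDiffAt_const.sub χ.contDiff.contDiffAt)
      · exact contDiffAt_inv ℝ hy
  have hinv : ∀ y, ε ≤ ‖y‖ → b y = y⁻¹ := by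
    intro y hy
    have : χ y = 0 := χ.zero_of_le_dist (by simpa using hy)
    simp [b, this]
  let Λ : ℂ →L[ℝ] ℂ →L[ℝ] ℂ := -ContinuousLinearMap.mul ℝ ℂ
  -- the error term in `b' = -b² dy`, which vanishes where `b = 1 / y`
  let k : ℂ → (ℂ →L[ℝ] ℂ) := fun y => fderiv ℝ b y - Λ (b y * b y)
  have hk : ContDiff ℝ ∞ k :=
    (hb.fderiv_right (m := ∞) (by simp)).sub (Λ.contDiff.comp (hb.mul hb))
  have hkc : HasCompactSupport k := by
    refine HasCompactSupport.intro (isCompact_closedBall (0 : ℂ) ε) fun y hy => ?_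
    have hy' : ε < ‖y‖ := by simpa using hy
    have hy0 : y ≠ 0 := by rintro rfl; simp at hy'; linarith
    have h1 : b =ᶠ[nhds y] fun y => y⁻¹ := by
      filter_upwards [continuous_norm.continuousAt.eventually (lt_mem_nhds hy')] with w hw
      exact hinv w hw.le
    have h2 : HasFDerivAt (fun y : ℂ => y⁻¹) (Λ (b y * b y)) y := by
      have := (hasDerivAt_inv hy0).hasFDerivAt.restrictScalars ℝ
      refine this.congr_fderiv ?_
      ext1; simp [Λ, hinv y hy'.le]; field_simp
    simp only [k]
    rw [h1.fderiv_eq, h2.fderiv, sub_self]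
  refine ⟨b, ⟨hb, fun n => ?_⟩, hinv⟩
  induction n using Nat.strong_induction_on with
  | _ n ih =>
    rcases n with _ | n
    · refine ⟨2 / ε, fun y => ?_⟩
      rw [norm_iteratedFDeriv_zero]
      by_cases hy : ε / 2 ≤ ‖y‖
      · have h1 : ‖((1 - χ y : ℝ) : ℂ)‖ ≤ 1 := by
          rw [Complex.norm_real, Real.norm_eq_abs, abs_le]
          constructor <;> linarith [χ.nonneg' y, χ.le_one (x := y)]
        have h2 : ‖y⁻¹‖ ≤ 2 / ε := by
          rw [norm_inv, ← inv_div]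
          exact inv_anti₀ (by positivity) hy
        simp only [b, norm_mul]
        calc _ ≤ 1 * (2 / ε) := mul_le_mul h1 h2 (norm_nonneg _) zero_le_one
          _ = _ := one_mul _
      · have : χ y = 1 := χ.one_of_mem_closedBall (by simpa using (not_le.mp hy).le)
        simp [b, this]
        positivity
    · have ih' : ∀ i, ∃ C : ℝ, i ≤ n → ∀ y, ‖iteratedFDeriv ℝ i b y‖ ≤ C := by
        intro i
        by_cases hi : i ≤ n
        · obtain ⟨C, hC⟩ := ih i (by omega)
          exact ⟨C, fun _ => hC⟩
        · exact ⟨0, fun h => absurd h hi⟩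
      choose A hA using ih'
      obtain ⟨D, hD⟩ := exists_bound_iteratedFDeriv_of_hasCompactSupport hk hkc n
      refine ⟨D + ‖Λ‖ * ∑ i ∈ Finset.range (n + 1), (n.choose i : ℝ) * A i * A (n - i),
        fun y => ?_⟩
      have hfd : fderiv ℝ b = fun y => k y + Λ (b y * b y) := by
        ext1 y; simp [k]
      have hΛ : ContDiff ℝ ∞ fun y => Λ (b y * b y) := Λ.contDiff.comp (hb.mul hb)
      rw [← norm_iteratedFDeriv_fderiv, hfd, fun_iteratedFDeriv_add_apply
        (hk.of_le (mod_cast le_top)).contDiffAt (hΛ.of_le (mod_cast le_top)).contDiffAt]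
      refine (norm_add_le _ _).trans (add_le_add (hD y) ?_)
      refine (Λ.norm_iteratedFDeriv_comp_left (f := fun y => b y * b y) (x := y)
        (hb.mul hb).contDiffAt (mod_cast le_top)).trans ?_
      refine mul_le_mul_of_nonneg_left ?_ (norm_nonneg _)
      refine (norm_iteratedFDeriv_mul_le hb hb y (n := n) (mod_cast le_top)).trans ?_
      refine Finset.sum_le_sum fun i hi => ?_
      have hi' : i ≤ n := by simpa [Nat.lt_succ_iff] using hi
      rw [mul_assoc, mul_assoc]
      refine mul_le_mul_of_nonneg_left ?_ (Nat.cast_nonneg _)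
      exact mul_le_mul (hA i hi' y) (hA (n - i) (by omega) y) (norm_nonneg _)
        ((norm_nonneg _).trans (hA i hi' y))

theorem norm_iteratedFDeriv_comp_snd_sub_le {b : ℂ → ℂ} (hb : ContDiff ℝ ∞ b) {n : ℕ} {C : ℝ}
    (hC : ∀ y, ‖iteratedFDeriv ℝ n b y‖ ≤ C) (z : ℂ) (p : ℂ × ℂ) :
    ‖iteratedFDeriv ℝ n (fun p : ℂ × ℂ => b (p.2 - z)) p‖ ≤ C := by
  have hbz : ContDiff ℝ ∞ fun y => b (y - z) := hb.comp (contDiff_id.sub contDiff_const)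
  have h := (ContinuousLinearMap.snd ℝ ℂ ℂ).iteratedFDeriv_comp_right
    (f := fun y => b (y - z)) hbz p (i := n) (mod_cast le_top)
  have h' : (fun p : ℂ × ℂ => b (p.2 - z)) = (fun y => b (y - z)) ∘ ContinuousLinearMap.snd ℝ ℂ ℂ :=
    rfl
  rw [h', h, iteratedFDeriv_comp_sub]
  refine (ContinuousMultilinearMap.norm_compContinuousLinearMap_le _ _).trans ?_
  refine (mul_le_of_le_one_right (norm_nonneg _) ?_).trans (hC _)
  exact Finset.prod_le_one (fun _ _ => norm_nonneg _)
    fun _ _ => ContinuousLinearMap.norm_snd_le ℝ ℂ ℂ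

theorem SmoothBounded.comp_snd_sub_mem {b : ℂ → ℂ} (hb : SmoothBounded b) (z : ℂ) :
    (fun p : ℂ × ℂ => b (p.2 - z)) ∈ slowlyIncreasing := by
  refine ⟨hb.1.comp (contDiff_snd.sub contDiff_const), 0, fun n => ?_⟩
  obtain ⟨C, hC⟩ := hb.2 n
  exact ⟨C, fun p => by simpa using norm_iteratedFDeriv_comp_snd_sub_le hb.1 hC z p⟩

/-- Leibniz bounds for a product, all derivatives up to a given order being bounded at once. -/
theorem norm_iteratedFDeriv_mul_le_of_le {f g : ℂ × ℂ → ℂ} (hf : ContDiff ℝ ∞ f)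
    (hg : ContDiff ℝ ∞ g) {m k : ℕ} {A B : ℝ} (hA : 0 ≤ A) (hB : 0 ≤ B)
    (hfA : ∀ j ≤ m, ∀ p, ‖iteratedFDeriv ℝ j f p‖ ≤ A * (1 + ‖p‖) ^ k)
    (hgB : ∀ j ≤ m, ∀ p, ‖iteratedFDeriv ℝ j g p‖ ≤ B) :
    ∀ j ≤ m, ∀ p, ‖iteratedFDeriv ℝ j (fun p => f p * g p) p‖ ≤
      (A * (2 ^ m * B)) * (1 + ‖p‖) ^ k := by
  intro j hj p
  refine (norm_iteratedFDeriv_mul_le hf hg p (n := j) (mod_cast le_top)).trans ?_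
  have hX : 0 ≤ A * (1 + ‖p‖) ^ k := by positivity
  calc _ ≤ ∑ i ∈ Finset.range (j + 1), (j.choose i : ℝ) * (A * (1 + ‖p‖) ^ k * B) := by
        refine Finset.sum_le_sum fun i hi => ?_
        have hi' : i ≤ j := by simpa [Nat.lt_succ_iff] using hi
        rw [mul_assoc]
        refine mul_le_mul_of_nonneg_left ?_ (Nat.cast_nonneg _)
        exact mul_le_mul (hfA i (hi'.trans hj) p) (hgB _ (by omega) p) (norm_nonneg _) hX
    _ = 2 ^ j * (A * (1 + ‖p‖) ^ k * B) := by
        rw [← Finset.sum_mul]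
        congr 1
        exact_mod_cast Nat.sum_range_choose j
    _ ≤ 2 ^ m * (A * (1 + ‖p‖) ^ k * B) := by
        refine mul_le_mul_of_nonneg_right ?_ (by positivity)
        exact pow_le_pow_right₀ one_le_two hj
    _ = _ := by ring

namespace GeneralizedKernel

/-! ### The pairing with functions that are singular off the support -/

theorem isClosed_suppY (u : GeneralizedKernel) : IsClosed u.suppY :=
  isClosed_sInter fun _ hF => hF.1

/-- The kernel vanishes on test functions supported over a compact set of `y`'s disjoint from
`supp_y(u)`. Compactness is what allows to pass from the closed sets over whose complement `u`
vanishes to their intersection: if `χ` cuts off to a set of `y`'s over which `u` vanishes, and so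
does `η`, then so does `χ + η - χ η`. -/
theorem map_eq_zero_of_isCompact (u : GeneralizedKernel) {K : Set ℂ} (hK : IsCompact K)
    (hd : Disjoint K u.suppY) (f : slowlyIncreasing)
    (hf : ∀ x y : ℂ, y ∉ K → (f : ℂ × ℂ → ℂ) (x, y) = 0) : u.toFun f = 0 := by
  have key : ∃ χ : slowlyIncreasing, (∀ x y : ℂ, y ∈ K → (χ : ℂ × ℂ → ℂ) (x, y) = 1) ∧
      ∀ g : slowlyIncreasing, u.toFun (g * χ) = 0 := by
    refine hK.induction_on (p := fun s => ∃ χ : slowlyIncreasing,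
      (∀ x y : ℂ, y ∈ s → (χ : ℂ × ℂ → ℂ) (x, y) = 1) ∧
      ∀ g : slowlyIncreasing, u.toFun (g * χ) = 0) ?_ ?_ ?_ ?_
    · exact ⟨0, by simp, by simp⟩
    · rintro s t hst ⟨χ, h1, h2⟩
      exact ⟨χ, fun x y hy => h1 x y (hst hy), h2⟩
    · rintro s t ⟨χ, h1, h2⟩ ⟨η, h3, h4⟩
      refine ⟨χ + η - χ * η, ?_, fun g => ?_⟩
      · rintro x y (hy | hy)
        · simp [h1 x y hy]
        · simp [h3 x y hy]
      · have : g * (χ + η - χ * η) = g * χ + g * η - (g * χ) * η := by ring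
        rw [this, map_sub, map_add, h2, h4, h4]
        simp
    · intro w hw
      have hw' : w ∉ u.suppY := fun h => Set.disjoint_left.mp hd hw h
      simp only [suppY, Set.mem_sInter, not_forall] at hw'
      obtain ⟨F, ⟨hF, hFu⟩, hwF⟩ := hw'
      obtain ⟨ε, hε, hball⟩ := Metric.nhds_basis_closedBall.mem_iff.mp (hF.isOpen_compl.mem_nhds hwF)
      let χ : ContDiffBump w := ⟨ε / 2, ε, by positivity, by linarith⟩
      have hχ : ContDiff ℝ ∞ fun y => (χ y : ℂ) := Complex.ofRealCLM.contDiff.comp χ.contDiff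
      have hχs : ∀ y, y ∉ Metric.closedBall w ε → (χ y : ℂ) = 0 := fun y hy => by
        have : χ y = 0 := χ.zero_of_le_dist (by simpa using (not_le.mp hy).le)
        simp [this]
      have hχb : SmoothBounded fun y => (χ y : ℂ) :=
        ⟨hχ, exists_bound_iteratedFDeriv_of_hasCompactSupport hχ
          (HasCompactSupport.intro (isCompact_closedBall w ε) hχs)⟩
      refine ⟨Metric.closedBall w (ε / 2), mem_nhdsWithin_of_mem_nhds
        (Metric.closedBall_mem_nhds _ (by positivity)),
        ⟨_, hχb.comp_snd_sub_mem 0⟩, fun x y hy => ?_, fun g => ?_⟩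
      · have : χ y = 1 := χ.one_of_mem_closedBall hy
        simp [this]
      · refine hFu _ fun p hp => ?_
        have hcl : IsClosed {p : ℂ × ℂ | p.2 ∈ Metric.closedBall w ε} :=
          Metric.isClosed_closedBall.preimage continuous_snd
        refine hball (closure_minimal ?_ hcl hp)
        intro p hp
        by_contra h
        refine hp ?_
        have := hχs p.2 h
        simp [this]
  obtain ⟨χ, h1, h2⟩ := key
  have : f = f * χ := by
    ext ⟨x, y⟩
    by_cases hy : y ∈ K
    · simp [h1 x y hy]
    · simp [hf x y hy]
  rw [this, h2]

theorem map_congr_of_isCompact (u : GeneralizedKernel) {K : Set ℂ} (hK : IsCompact K)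
    (hd : Disjoint K u.suppY) (f g : slowlyIncreasing)
    (hf : ∀ x y : ℂ, y ∉ K → (f : ℂ × ℂ → ℂ) (x, y) = (g : ℂ × ℂ → ℂ) (x, y)) :
    u.toFun f = u.toFun g := by
  rw [← sub_eq_zero, ← map_sub]
  exact u.map_eq_zero_of_isCompact hK hd _ fun x y hy => by simp [hf x y hy]

theorem pair_eq (u : GeneralizedKernel) {P : ℂ[X]} {R : ℂ → ℂ} {g : slowlyIncreasing}
    (hg : u.IsExtension P R g) : u.pair P R = u.toFun g := by
  have h : ∃ g, u.IsExtension P R g := ⟨g, hg⟩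
  rw [pair, dif_pos h]
  obtain ⟨K, hK, hKd, hKe⟩ := h.choose_spec
  obtain ⟨L, hL, hLd, hLe⟩ := hg
  refine u.map_congr_of_isCompact (hK.union hL) (hKd.union_left hLd) _ _ fun x y hy => ?_
  rw [Set.mem_union, not_or] at hy
  rw [hKe x y hy.1, hLe x y hy.2]

theorem coe_aeval_coordX (P : ℂ[X]) (x y : ℂ) :
    ((Polynomial.aeval coordX P : slowlyIncreasing) : ℂ × ℂ → ℂ) (x, y) = P.eval x := by
  induction P using Polynomial.induction_on' with
  | add p q hp hq => simp [hp, hq]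
  | monomial n a => simp [Polynomial.aeval_monomial, coordX, Algebra.algebraMap_eq_smul_one]

theorem coe_aeval_coordY (P : ℂ[X]) (x y : ℂ) :
    ((Polynomial.aeval coordY P : slowlyIncreasing) : ℂ × ℂ → ℂ) (x, y) = P.eval y := by
  induction P using Polynomial.induction_on' with
  | add p q hp hq => simp [hp, hq]
  | monomial n a => simp [Polynomial.aeval_monomial, coordY, Algebra.algebraMap_eq_smul_one]

theorem form_apply (u : GeneralizedKernel) (P Q : ℂ[X]) :
    u.form P Q = u.toFun (Polynomial.aeval coordX P * Polynomial.aeval coordY Q) := rfl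

/-! ### Second kind functions near a point off the support -/

/-- Off `supp_y(u)` the second kind functions are analytic, with Taylor coefficients
`-⟨P(x), (y - q)^{-(n + 1)}⟩_u`. The truncations of `1 / (y - z)`, for `z` near `q`, are taken to be
translates of one another, so that they satisfy uniform bounds. The remainder of the geometric
expansion of `1 / (z - y)` is then estimated by the continuity of `u`, in terms of derivatives up
to one fixed order, which grow at most geometrically. -/
theorem exists_inv_extension (u : GeneralizedKernel) {q : ℂ} (hq : q ∉ u.suppY) :
    ∃ K : Set ℂ, IsCompact K ∧ Disjoint K u.suppY ∧ ∃ B : slowlyIncreasing,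
      (∀ x y : ℂ, y ∉ K → (B : ℂ × ℂ → ℂ) (x, y) = (y - q)⁻¹) ∧
      ∀ P : ℂ[X], HasFPowerSeriesAt (u.secondKind P) (FormalMultilinearSeries.ofScalars ℂ
        fun n => -u.toFun (Polynomial.aeval coordX P * B ^ (n + 1))) q := by
  obtain ⟨δ, hδ, hball⟩ := Metric.nhds_basis_closedBall.mem_iff.mp
    (u.isClosed_suppY.isOpen_compl.mem_nhds hq)
  -- the truncations at `z` with `|z - q| < ε = δ / 2` differ from `1 / (y - z)` only where
  -- `|y - q| ≤ δ`
  set ε := δ / 2 with hε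
  have hε0 : 0 < ε := by positivity
  obtain ⟨b, hb, hbinv⟩ := exists_smoothBounded_eq_inv hε0
  have hK : IsCompact (Metric.closedBall q δ) := isCompact_closedBall q δ
  have hKd : Disjoint (Metric.closedBall q δ) u.suppY :=
    Set.disjoint_left.mpr fun y hy => hball hy
  let B : ℂ → slowlyIncreasing := fun z => ⟨_, hb.comp_snd_sub_mem z⟩
  have hB : ∀ z, ‖z - q‖ < ε → ∀ x y : ℂ, y ∉ Metric.closedBall q δ →
      (B z : ℂ × ℂ → ℂ) (x, y) = (y - z)⁻¹ ∧ y - z ≠ 0 := by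
    intro z hz x y hy
    have hy' : δ < ‖y - q‖ := by simpa [dist_eq_norm] using hy
    have h : ε ≤ ‖y - z‖ := by
      have := norm_sub_le_norm_sub_add_norm_sub y z q
      linarith
    exact ⟨hbinv _ h, norm_pos_iff.mp (hε0.trans_le h)⟩
  have hqq : ‖q - q‖ < ε := by simpa using hε0
  refine ⟨_, hK, hKd, B q, fun x y hy => (hB q hqq x y hy).1, fun P => ?_⟩
  set F : slowlyIncreasing := Polynomial.aeval coordX P with hF
  obtain ⟨-, k, hFk⟩ := F.2
  obtain ⟨m, C, hC⟩ := u.continuous' k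
  have hbd : ∃ A : ℝ, 0 ≤ A ∧ ∀ j ≤ m, ∀ y, ‖iteratedFDeriv ℝ j b y‖ ≤ A := by
    choose A hA using hb.2
    refine ⟨∑ i ∈ Finset.range (m + 1), |A i|, by positivity, fun j hj y => ?_⟩
    refine (hA j y).trans ((le_abs_self _).trans ?_)
    exact Finset.single_le_sum (f := fun i => |A i|) (fun i _ => abs_nonneg _)
      (Finset.mem_range.mpr (by omega))
  obtain ⟨A, hA0, hA⟩ := hbd
  have hFd : ∃ D : ℝ, 0 ≤ D ∧ ∀ j ≤ m, ∀ p,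
      ‖iteratedFDeriv ℝ j (F : ℂ × ℂ → ℂ) p‖ ≤ D * (1 + ‖p‖) ^ k := by
    choose D hD using hFk
    refine ⟨∑ i ∈ Finset.range (m + 1), |D i|, by positivity, fun j hj p => ?_⟩
    refine (hD j p).trans (mul_le_mul_of_nonneg_right ((le_abs_self _).trans ?_) (by positivity))
    exact Finset.single_le_sum (f := fun i => |D i|) (fun i _ => abs_nonneg _)
      (Finset.mem_range.mpr (by omega))
  obtain ⟨D, hD0, hD⟩ := hFd
  set ρ : ℝ := 2 ^ m * A with hρ
  have hρ0 : 0 ≤ ρ := by positivity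
  have hBA : ∀ z, ∀ j ≤ m, ∀ p, ‖iteratedFDeriv ℝ j (B z : ℂ × ℂ → ℂ) p‖ ≤ A :=
    fun z j hj p => norm_iteratedFDeriv_comp_snd_sub_le hb.1 (hA j hj) z p
  have hpow : ∀ n : ℕ, ∀ j ≤ m, ∀ p,
      ‖iteratedFDeriv ℝ j ((F * B q ^ n : slowlyIncreasing) : ℂ × ℂ → ℂ) p‖ ≤
        (D * ρ ^ n) * (1 + ‖p‖) ^ k := by
    intro n
    induction n with
    | zero => simpa using hD
    | succ n ih =>
      have h := norm_iteratedFDeriv_mul_le_of_le (F * B q ^ n).2.1 (B q).2.1 (by positivity) hA0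
        ih (hBA q)
      intro j hj p
      have e : ((F * B q ^ (n + 1) : slowlyIncreasing) : ℂ × ℂ → ℂ) =
          fun p => ((F * B q ^ n : slowlyIncreasing) : ℂ × ℂ → ℂ) p * (B q : ℂ × ℂ → ℂ) p := by
        rw [pow_succ, ← mul_assoc]; rfl
      rw [e, pow_succ, ← mul_assoc D]
      exact h j hj p
  have hbound : ∀ n z, ‖u.toFun (F * B q ^ n * B z)‖ ≤ |C| * (D * ρ ^ (n + 1)) := by
    intro n z
    refine (hC (F * B q ^ n * B z) (D * ρ ^ (n + 1)) ?_).trans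
      (mul_le_mul_of_nonneg_right (le_abs_self C) (by positivity))
    rw [pow_succ, ← mul_assoc D]
    exact norm_iteratedFDeriv_mul_le_of_le (F * B q ^ n).2.1 (B z).2.1 (by positivity) hA0
      (hpow n) (hBA z)
  have hsecond : ∀ z, ‖z - q‖ < ε → u.secondKind P z = -u.toFun (F * B z) := by
    intro z hz
    rw [secondKind, u.pair_eq (g := -(F * B z)), map_neg]
    refine ⟨_, hK, hKd, fun x y hy => ?_⟩
    obtain ⟨h1, h2⟩ := hB z hz x y hy
    have h3 : z - y ≠ 0 := by rw [← neg_sub]; exact neg_ne_zero.mpr h2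
    have e : ((-(F * B z) : slowlyIncreasing) : ℂ × ℂ → ℂ) (x, y) =
      -((F : ℂ × ℂ → ℂ) (x, y) * (B z : ℂ × ℂ → ℂ) (x, y)) := rfl
    rw [e, h1, hF, coe_aeval_coordX]
    have : (y - z)⁻¹ = -(z - y)⁻¹ := by rw [← inv_neg, neg_sub]
    rw [this]
    ring
  -- one step of the geometric expansion of `1 / (y - z)` at `q`
  have hstep : ∀ z, ‖z - q‖ < ε → ∀ n, u.toFun (F * B q ^ n * B z) =
      u.toFun (F * B q ^ (n + 1)) + (z - q) * u.toFun (F * B q ^ (n + 1) * B z) := by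
    intro z hz n
    rw [← smul_eq_mul (z - q), ← map_smul, ← map_add]
    refine u.map_congr_of_isCompact hK hKd _ _ fun x y hy => ?_
    obtain ⟨h1, h2⟩ := hB z hz x y hy
    obtain ⟨h3, h4⟩ := hB q hqq x y hy
    have e1 : ((F * B q ^ n * B z : slowlyIncreasing) : ℂ × ℂ → ℂ) (x, y) =
      (F : ℂ × ℂ → ℂ) (x, y) * (B q : ℂ × ℂ → ℂ) (x, y) ^ n * (B z : ℂ × ℂ → ℂ) (x, y) := rfl
    have e2 : ((F * B q ^ (n + 1) + (z - q) • (F * B q ^ (n + 1) * B z) :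
        slowlyIncreasing) : ℂ × ℂ → ℂ) (x, y) =
      (F : ℂ × ℂ → ℂ) (x, y) * (B q : ℂ × ℂ → ℂ) (x, y) ^ (n + 1) + (z - q) *
      ((F : ℂ × ℂ → ℂ) (x, y) * (B q : ℂ × ℂ → ℂ) (x, y) ^ (n + 1) * (B z : ℂ × ℂ → ℂ) (x, y)) :=
      rfl
    rw [e1, e2, h1, h3, pow_succ]
    have : (y - z)⁻¹ = (y - q)⁻¹ + (z - q) * ((y - q)⁻¹ * (y - z)⁻¹) := by
      field_simp
      ring
    linear_combination (F : ℂ × ℂ → ℂ) (x, y) * (y - q)⁻¹ ^ n * this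
  have hsum : ∀ z, ‖z - q‖ < ε → ∀ n, u.toFun (F * B z) =
      ∑ i ∈ Finset.range n, (z - q) ^ i * u.toFun (F * B q ^ (i + 1)) +
        (z - q) ^ n * u.toFun (F * B q ^ n * B z) := by
    intro z hz n
    induction n with
    | zero => simp
    | succ n ih =>
      rw [ih, hstep z hz n, Finset.sum_range_succ, pow_succ]
      ring
  rw [hasFPowerSeriesAt_iff]
  have hlim : Filter.Tendsto (fun w : ℂ => ‖w‖ * (ρ + 1)) (nhds 0) (nhds 0) := by
    have : Continuous fun w : ℂ => ‖w‖ * (ρ + 1) := by fun_prop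
    simpa using this.tendsto 0
  filter_upwards [hlim.eventually (gt_mem_nhds zero_lt_one), Metric.ball_mem_nhds (0 : ℂ) hε0]
    with w hw1 hw2
  have hwε : ‖(q + w) - q‖ < ε := by simpa using hw2
  have hr : ‖w‖ * ρ < 1 := by nlinarith [norm_nonneg w]
  have hr0 : 0 ≤ ‖w‖ * ρ := by positivity
  have hterm : ∀ n, ‖w ^ n * u.toFun (F * B q ^ n * B (q + w))‖ ≤
      (|C| * D * ρ) * (‖w‖ * ρ) ^ n := by
    intro n
    rw [norm_mul, norm_pow]
    calc _ ≤ ‖w‖ ^ n * (|C| * (D * ρ ^ (n + 1))) :=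
          mul_le_mul_of_nonneg_left (hbound n _) (by positivity)
      _ = _ := by rw [mul_pow, pow_succ]; ring
  have hterm' : ∀ n, ‖w ^ n * -u.toFun (F * B q ^ (n + 1))‖ ≤
      (|C| * D * ρ) * (‖w‖ * ρ) ^ n := by
    intro n
    have h := hbound n q
    rw [mul_assoc, ← pow_succ] at h
    rw [norm_mul, norm_neg, norm_pow]
    calc _ ≤ ‖w‖ ^ n * (|C| * (D * ρ ^ (n + 1))) :=
          mul_le_mul_of_nonneg_left h (by positivity)
      _ = _ := by rw [mul_pow, pow_succ]; ring
  have hgeo := (summable_geometric_of_lt_one hr0 hr).mul_left (|C| * D * ρ)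
  simp only [FormalMultilinearSeries.coeff_ofScalars, smul_eq_mul]
  refine (Summable.of_norm_bounded hgeo hterm').hasSum_iff_tendsto_nat.mpr ?_
  have hrem := squeeze_zero_norm hterm hgeo.tendsto_atTop_zero
  rw [hsecond _ hwε]
  have := (hrem.sub_const (u.toFun (F * B (q + w))))
  rw [zero_sub] at this
  refine this.congr fun n => ?_
  rw [hsum _ hwε n, add_sub_cancel_left]
  simp only [mul_neg, Finset.sum_neg_distrib]
  ring

theorem analyticAt_secondKind (u : GeneralizedKernel) {q : ℂ} (hq : q ∉ u.suppY) (P : ℂ[X]) :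
    AnalyticAt ℂ (u.secondKind P) q := by
  obtain ⟨K, -, -, B, -, hB⟩ := u.exists_inv_extension hq
  exact ⟨_, hB P⟩

/-- The Taylor coefficients of the second kind functions as pairings; the values of `R` on a
compact set off the support are immaterial. -/
theorem iteratedDeriv_secondKind (u : GeneralizedKernel) {q : ℂ} (hq : q ∉ u.suppY) (P : ℂ[X])
    {L : Set ℂ} (hL : IsCompact L) (hLd : Disjoint L u.suppY) (n : ℕ) {R : ℂ → ℂ}
    (hR : ∀ y ∉ L, R y = ((y - q) ^ (n + 1))⁻¹) :
    iteratedDeriv n (u.secondKind P) q / (n ! : ℂ) = -u.pair P R := by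
  obtain ⟨K, hK, hKd, B, hBK, hB⟩ := u.exists_inv_extension hq
  have h := (u.analyticAt_secondKind hq P).hasFPowerSeriesAt.eq_formalMultilinearSeries (hB P)
  have h' := congrArg (fun p => p.coeff n) h
  simp only [FormalMultilinearSeries.coeff_ofScalars] at h'
  rw [h', u.pair_eq (g := Polynomial.aeval coordX P * B ^ (n + 1))]
  refine ⟨K ∪ L, hK.union hL, hKd.union_left hLd, fun x y hy => ?_⟩
  rw [Set.mem_union, not_or] at hy
  have e : ((Polynomial.aeval coordX P * B ^ (n + 1) : slowlyIncreasing) : ℂ × ℂ → ℂ) (x, y) =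
    ((Polynomial.aeval coordX P : slowlyIncreasing) : ℂ × ℂ → ℂ) (x, y) *
      (B : ℂ × ℂ → ℂ) (x, y) ^ (n + 1) := rfl
  rw [e, coe_aeval_coordX, hBK x y hy.1, hR y hy.2, inv_pow]

section Perturbation

variable {d : ℕ} (q : Fin d → ℂ) (m : Fin d → ℕ)

/-- The form `⟨P(x), Q(y) / W(y)⟩_u` is computed by a test function that extends `1 / W(y)`. -/
theorem exists_pair_div_pertPoly (u : GeneralizedKernel) (hsupp : ∀ i, q i ∉ u.suppY) :
    ∃ V : slowlyIncreasing, ∀ P Q : ℂ[X],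
      u.pair P (fun y => Q.eval y / (pertPoly q m).eval y) =
        u.toFun (Polynomial.aeval coordX P * Polynomial.aeval coordY Q * V) := by
  choose K hK hKd B hBK _ using fun i => u.exists_inv_extension (hsupp i)
  refine ⟨∏ i, B i ^ m i, fun P Q => u.pair_eq ⟨⋃ i, K i, isCompact_iUnion hK,
    Set.disjoint_iUnion_left.mpr hKd, fun x y hy => ?_⟩⟩
  rw [Set.mem_iUnion, not_exists] at hy
  have e : ((∏ i, B i ^ m i : slowlyIncreasing) : ℂ × ℂ → ℂ) (x, y) =
      ∏ i, (B i : ℂ × ℂ → ℂ) (x, y) ^ m i := by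
    simp [Finset.prod_apply]
  have e' : ((Polynomial.aeval coordX P * Polynomial.aeval coordY Q * (∏ i, B i ^ m i) :
      slowlyIncreasing) : ℂ × ℂ → ℂ) (x, y) =
    ((Polynomial.aeval coordX P : slowlyIncreasing) : ℂ × ℂ → ℂ) (x, y) *
      ((Polynomial.aeval coordY Q : slowlyIncreasing) : ℂ × ℂ → ℂ) (x, y) *
      ((∏ i, B i ^ m i : slowlyIncreasing) : ℂ × ℂ → ℂ) (x, y) := rfl
  rw [e', e, coe_aeval_coordX, coe_aeval_coordY, Finset.prod_congr rfl
    fun i _ => by rw [hBK i x y (hy i)]]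
  simp [pertPoly, Polynomial.eval_prod, div_eq_mul_inv, mul_assoc]

theorem isCompact_range_nodes : IsCompact (Set.range q) := (Set.finite_range q).isCompact

theorem disjoint_range_nodes (u : GeneralizedKernel) (hsupp : ∀ i, q i ∉ u.suppY) :
    Disjoint (Set.range q) u.suppY := by
  rw [Set.disjoint_left]
  rintro _ ⟨i, rfl⟩
  exact hsupp i

theorem eval_pertPoly_ne_zero {y : ℂ} (hy : y ∉ Set.range q) : (pertPoly q m).eval y ≠ 0 := by
  rw [pertPoly, Polynomial.eval_prod, Finset.prod_ne_zero_iff]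
  intro i _
  simpa using pow_ne_zero _ (sub_ne_zero.mpr fun h => hy ⟨i, h.symm⟩)

theorem pair_mul_pertPoly_div (u : GeneralizedKernel) (hsupp : ∀ i, q i ∉ u.suppY) (P Q : ℂ[X]) :
    u.pair P (fun y => (Q * pertPoly q m).eval y / (pertPoly q m).eval y) = u.form P Q := by
  rw [form_apply, u.pair_eq]
  refine ⟨_, isCompact_range_nodes q, disjoint_range_nodes q u hsupp, fun x y hy => ?_⟩
  have e : ((Polynomial.aeval coordX P * Polynomial.aeval coordY Q :
      slowlyIncreasing) : ℂ × ℂ → ℂ) (x, y) =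
    ((Polynomial.aeval coordX P : slowlyIncreasing) : ℂ × ℂ → ℂ) (x, y) *
      ((Polynomial.aeval coordY Q : slowlyIncreasing) : ℂ × ℂ → ℂ) (x, y) := rfl
  rw [e, coe_aeval_coordX, coe_aeval_coordY]
  beta_reduce
  rw [Polynomial.eval_mul,
    mul_div_cancel_right₀ _ (eval_pertPoly_ne_zero q m hy)]

end Perturbation

end GeneralizedKernel

/-! ### Biorthogonal polynomials -/

theorem coeff_polyOf (S : Matrix ℕ ℕ ℂ) (n k : ℕ) :
    (polyOf S n).coeff k = if k ≤ n then S n k else 0 := by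
  simp [polyOf, Polynomial.finsetSum_coeff, Polynomial.coeff_X_pow]

theorem natDegree_polyOf_le (S : Matrix ℕ ℕ ℂ) (n : ℕ) :
    (polyOf S n).natDegree ≤ n := by
  rw [Polynomial.natDegree_le_iff_coeff_eq_zero]
  intro k hk
  simp [coeff_polyOf, hk.not_ge]

namespace LowerUnitriangular

variable {S : Matrix ℕ ℕ ℂ} (hS : LowerUnitriangular S)
include hS

theorem monic_polyOf (n : ℕ) : (polyOf S n).Monic :=
  Polynomial.monic_of_natDegree_le_of_coeff_eq_one n (natDegree_polyOf_le S n)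
    (by simp [coeff_polyOf, hS.diag])

theorem natDegree_polyOf (n : ℕ) : (polyOf S n).natDegree = n :=
  le_antisymm (natDegree_polyOf_le S n)
    (Polynomial.le_natDegree_of_ne_zero (by simp [coeff_polyOf, hS.diag]))

theorem degree_polyOf (n : ℕ) : (polyOf S n).degree = n := by
  rw [Polynomial.degree_eq_natDegree (hS.monic_polyOf n).ne_zero, hS.natDegree_polyOf]

theorem degree_sub_polyOf_lt {Q : ℂ[X]} {n : ℕ} (hQ : Q.Monic) (hn : Q.natDegree = n) :
    (Q - polyOf S n).degree < n := by
  have h : Q.degree = n := by rw [Polynomial.degree_eq_natDegree hQ.ne_zero, hn]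
  rw [← h]
  refine Polynomial.degree_sub_lt_left (by rw [h, hS.degree_polyOf]) hQ.ne_zero ?_
  rw [hQ.leadingCoeff, (hS.monic_polyOf n).leadingCoeff]

theorem exists_eq_sum_polyOf {n : ℕ} {Q : ℂ[X]} (hQ : Q.degree < n) :
    ∃ c : ℕ → ℂ, Q = ∑ k ∈ Finset.range n, c k • polyOf S k := by
  induction n generalizing Q with
  | zero =>
    have h := (Polynomial.degree_lt_iff_coeff_zero Q 0).mp hQ
    exact ⟨0, by simpa using Polynomial.ext fun k => h k k.zero_le⟩
  | succ n ih =>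
    have h : (Q - Q.coeff n • polyOf S n).degree < n := by
      rw [Polynomial.degree_lt_iff_coeff_zero]
      intro k hk
      rcases hk.eq_or_lt with rfl | hk
      · simp [coeff_polyOf, hS.diag]
      · have h1 := (Polynomial.degree_lt_iff_coeff_zero _ _).mp hQ k hk
        simp [coeff_polyOf, h1, hk.not_ge]
    obtain ⟨c, hc⟩ := ih h
    refine ⟨Function.update c n (Q.coeff n), ?_⟩
    rw [Finset.sum_range_succ, Function.update_self, Finset.sum_congr rfl fun k hk => by
      rw [Function.update_of_ne (Finset.mem_range.mp hk).ne], ← hc, sub_add_cancel]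

end LowerUnitriangular

/-- The form is nondegenerate on the polynomials of degree less than `n`. -/
theorem QuasiDefinite.eq_zero {B : LinearMap.BilinForm ℂ ℂ[X]} (hB : QuasiDefinite B) {n : ℕ}
    {P : ℂ[X]} (hP : P.degree < n) (h : ∀ Q : ℂ[X], Q.degree < n → B P Q = 0) : P = 0 := by
  have hv : (fun i : Fin n => P.coeff i) = 0 := by
    refine Matrix.eq_zero_of_vecMul_eq_zero (hB n) ?_
    ext j
    have hn : P.natDegree < n := by
      by_cases hP0 : P = 0
      · simpa [hP0] using j.pos
      · exact (Polynomial.natDegree_lt_iff_degree_lt hP0).mpr hP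
    have h1 := h (Polynomial.X ^ (j : ℕ)) (by
      rw [Polynomial.degree_X_pow]; exact_mod_cast j.2)
    have hPs : P = ∑ i : Fin n, P.coeff i • Polynomial.X ^ (i : ℕ) := by
      rw [Fin.sum_univ_eq_sum_range (fun i => P.coeff i • (Polynomial.X : ℂ[X]) ^ i) n]
      conv_lhs => rw [Polynomial.as_sum_range' P n (hn)]
      simp [← Polynomial.C_mul_X_pow_eq_monomial, Polynomial.smul_eq_C_mul]
    rw [hPs] at h1
    simpa [Matrix.vecMul, dotProduct] using h1
  ext k
  by_cases hk : k < n
  · exact congrFun hv ⟨k, hk⟩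
  · simpa using (Polynomial.degree_lt_iff_coeff_zero _ _).mp hP k (not_lt.mp hk)

namespace IsGaussBorel

variable {B : LinearMap.BilinForm ℂ ℂ[X]} {S₁ S₂ : Matrix ℕ ℕ ℂ} {H : ℕ → ℂ}
  (h : IsGaussBorel B S₁ S₂ H)
include h

theorem apply_polyOf (k l : ℕ) : B (polyOf S₁ k) (polyOf S₂ l) = if k = l then H k else 0 := by
  rw [← h.factor k l]
  simp only [polyOf, map_sum, LinearMap.sum_apply, ← Polynomial.smul_eq_C_mul, map_smul,
    LinearMap.smul_apply, smul_eq_mul]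
  rw [Finset.sum_comm]
  refine Finset.sum_congr rfl fun i _ => ?_
  rw [Finset.mul_sum]
  exact Finset.sum_congr rfl fun j _ => by ring

theorem apply_sum_polyOf (c : ℕ → ℂ) (n l : ℕ) (hl : l < n) :
    B (∑ k ∈ Finset.range n, c k • polyOf S₁ k) (polyOf S₂ l) = c l * H l := by
  simp [h.apply_polyOf, hl]

theorem apply_eq_zero {n : ℕ} {Q : ℂ[X]} (hQ : Q.degree < n) : B (polyOf S₁ n) Q = 0 := by
  obtain ⟨c, rfl⟩ := h.lower₂.exists_eq_sum_polyOf hQ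
  rw [map_sum]
  refine Finset.sum_eq_zero fun k hk => ?_
  rw [map_smul, h.apply_polyOf, if_neg (Finset.mem_range.mp hk).ne', smul_zero]

theorem apply_monic {n : ℕ} {Q : ℂ[X]} (hQ : Q.Monic) (hn : Q.natDegree = n) :
    B (polyOf S₁ n) Q = H n := by
  have h1 := h.apply_eq_zero (h.lower₂.degree_sub_polyOf_lt hQ hn)
  rw [map_sub, sub_eq_zero] at h1
  rw [h1, h.apply_polyOf, if_pos rfl]

theorem ne_zero (hB : QuasiDefinite B) (n : ℕ) : H n ≠ 0 := by
  intro h0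
  refine (h.lower₁.monic_polyOf n).ne_zero (hB.eq_zero (n := n + 1) ?_ fun Q hQ => ?_)
  · rw [h.lower₁.degree_polyOf]; exact_mod_cast n.lt_succ_self
  · obtain ⟨c, rfl⟩ := h.lower₂.exists_eq_sum_polyOf hQ
    rw [map_sum]
    refine Finset.sum_eq_zero fun k _ => ?_
    rw [map_smul, h.apply_polyOf]
    simp [h0]

/-- The Christoffel--Darboux kernel reproduces polynomials of small degree. -/
theorem apply_cdKernel (hB : QuasiDefinite B) {n : ℕ} {Q : ℂ[X]} (hQ : Q.degree < n) (y : ℂ) :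
    B (cdKernel S₁ S₂ H n y) Q = Q.eval y := by
  obtain ⟨c, rfl⟩ := h.lower₂.exists_eq_sum_polyOf hQ
  simp only [cdKernel, ← Polynomial.smul_eq_C_mul]
  rw [map_sum, Polynomial.eval_finsetSum]
  refine Finset.sum_congr rfl fun k hk => ?_
  rw [map_smul, h.apply_sum_polyOf _ _ _ (Finset.mem_range.mp hk), Polynomial.eval_smul,
    inv_mul_cancel_right₀ (h.ne_zero hB k)]

theorem apply_cdKernel_polyOf (n : ℕ) (y : ℂ) :
    B (cdKernel S₁ S₂ H n y) (polyOf S₂ n) = 0 := by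
  simp only [cdKernel, ← Polynomial.smul_eq_C_mul, map_sum, LinearMap.sum_apply, map_smul,
    LinearMap.smul_apply]
  refine Finset.sum_eq_zero fun k hk => ?_
  rw [h.apply_polyOf, if_neg (Finset.mem_range.mp hk).ne, smul_zero]

theorem degree_cdKernel_lt (n : ℕ) (y : ℂ) : (cdKernel S₁ S₂ H n y).degree < n := by
  rw [cdKernel, ← Polynomial.mem_degreeLT]
  refine Submodule.sum_mem _ fun k hk => ?_
  rw [← Polynomial.smul_eq_C_mul]
  refine Submodule.smul_mem _ _ ?_
  rw [Polynomial.mem_degreeLT, h.lower₁.degree_polyOf]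
  exact_mod_cast Finset.mem_range.mp hk

/-- A polynomial of degree less than `s + N` orthogonal to those of degree less than `s` is a
combination of the `N` biorthogonal polynomials of degrees `s, …, s + N - 1`. -/
theorem exists_eq_sum_of_orthogonal (hB : QuasiDefinite B) {s N : ℕ} {P : ℂ[X]}
    (hP : P.degree < (s + N : ℕ)) (hort : ∀ Q : ℂ[X], Q.degree < s → B P Q = 0) :
    ∃ c : Fin N → ℂ, P = ∑ r : Fin N, c r • polyOf S₁ (s + r) := by
  obtain ⟨c, rfl⟩ := h.lower₁.exists_eq_sum_polyOf hP
  refine ⟨fun r => c (s + r), ?_⟩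
  rw [Finset.sum_range_add, Fin.sum_univ_eq_sum_range (fun r => c (s + r) • polyOf S₁ (s + r)) N,
    add_eq_right]
  refine Finset.sum_eq_zero fun k hk => ?_
  have hk' := Finset.mem_range.mp hk
  have h1 := hort (polyOf S₂ k) (by rw [h.lower₂.degree_polyOf]; exact_mod_cast hk')
  rw [h.apply_sum_polyOf _ _ _ (by omega)] at h1
  rw [(mul_eq_zero.mp h1).resolve_right (h.ne_zero hB k), zero_smul]

end IsGaussBorel

/-! ### Quasi-determinants with a dependent last row -/

/-- The quasi-determinant of a matrix whose last row, up to the last entry, is a combination of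
the rows above. -/
theorem thetaStar_of_vecMul_eq {N : ℕ} (M : Matrix (Fin (N + 1)) (Fin (N + 1)) ℂ)
    (hM : IsUnit (M.submatrix Fin.castSucc Fin.castSucc).det) (w : Fin N → ℂ)
    (hw : ∀ c : Fin N, M (Fin.last N) c.castSucc = ∑ r, w r * M r.castSucc c.castSucc) :
    thetaStar M = M (Fin.last N) (Fin.last N) - ∑ r, w r * M r.castSucc (Fin.last N) := by
  set A := M.submatrix Fin.castSucc Fin.castSucc with hA
  have h1 : (fun c : Fin N => M (Fin.last N) c.castSucc) = Matrix.vecMul w A := by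
    ext c; exact hw c
  have h2 : Matrix.vecMul (fun c : Fin N => M (Fin.last N) c.castSucc) A⁻¹ = w := by
    rw [h1, Matrix.vecMul_vecMul, Matrix.mul_nonsing_inv _ hM, Matrix.vecMul_one]
  rw [thetaStar, Finset.sum_comm]
  congr 1
  refine Finset.sum_congr rfl fun j _ => ?_
  rw [← Finset.sum_mul]
  congr 1
  exact congrFun h2 j

/-! ### Jets of polynomials and the divisors of the perturbing polynomial -/

open Polynomial in
theorem eval_iterate_derivative_div_factorial (Q : ℂ[X]) (r : ℂ) (l : ℕ) :
    (derivative^[l] Q).eval r / (l ! : ℂ) = (taylor r Q).coeff l := by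
  rw [taylor_coeff, ← factorial_smul_hasseDeriv, LinearMap.smul_apply, nsmul_eq_mul,
    ← Polynomial.C_eq_natCast, eval_C_mul,
    mul_div_cancel_left₀ _ (by exact_mod_cast l.factorial_ne_zero)]

open Polynomial in
theorem X_sub_C_pow_dvd_iff_taylor (Q : ℂ[X]) (r : ℂ) (k : ℕ) :
    (X - C r) ^ k ∣ Q ↔ ∀ l < k, (taylor r Q).coeff l = 0 := by
  rw [X_sub_C_pow_dvd_iff, X_pow_dvd_iff]
  rfl

theorem iteratedDeriv_polynomial_eval (Q : ℂ[X]) (n : ℕ) :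
    iteratedDeriv n (fun x => Q.eval x) = fun x => (Polynomial.derivative^[n] Q).eval x := by
  induction n generalizing Q with
  | zero => simp
  | succ n ih =>
    rw [iteratedDeriv_succ']
    have : deriv (fun x => Q.eval x) = fun x => Q.derivative.eval x := by
      ext x; exact Q.deriv
    rw [this, ih, Function.iterate_succ_apply]

section Perturbation

variable {d : ℕ} (q : Fin d → ℂ) (m : Fin d → ℕ)

theorem jet_polynomial (Q : ℂ[X]) (c : Fin (∑ i, m i)) :
    jet q m (fun x => Q.eval x) c = (Polynomial.taylor (q (finSigmaFinEquiv.symm c).1) Q).coeff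
      (finSigmaFinEquiv.symm c).2 := by
  simp only [jet]
  rw [iteratedDeriv_polynomial_eval, eval_iterate_derivative_div_factorial]

theorem monic_pertPoly : (pertPoly q m).Monic :=
  Polynomial.monic_prod_of_monic _ _ fun i _ => (Polynomial.monic_X_sub_C (q i)).pow _

theorem natDegree_pertPoly : (pertPoly q m).natDegree = ∑ i, m i := by
  rw [pertPoly, Polynomial.natDegree_prod_of_monic _ _
    fun i _ => (Polynomial.monic_X_sub_C (q i)).pow _]
  simp

theorem pow_dvd_pertPoly (i : Fin d) :
    (Polynomial.X - Polynomial.C (q i)) ^ m i ∣ pertPoly q m :=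
  Finset.dvd_prod_of_mem (fun i => (Polynomial.X - Polynomial.C (q i)) ^ m i) (Finset.mem_univ i)

variable {q} in
theorem pertPoly_dvd_iff (hq : Function.Injective q) (Q : ℂ[X]) :
    pertPoly q m ∣ Q ↔ ∀ i, ∀ l < m i, (Polynomial.taylor (q i) Q).coeff l = 0 := by
  have hc : Pairwise (Function.onFun IsCoprime
      fun i => (Polynomial.X - Polynomial.C (q i)) ^ m i) :=
    fun i j hij => (Polynomial.pairwise_coprime_X_sub_C hq hij).pow
  have h1 : pertPoly q m ∣ Q ↔ ∀ i, (Polynomial.X - Polynomial.C (q i)) ^ m i ∣ Q :=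
    ⟨fun h i => (pow_dvd_pertPoly q m i).trans h,
      fun h => Fintype.prod_dvd_of_coprime hc h⟩
  exact h1.trans (forall_congr' fun i => X_sub_C_pow_dvd_iff_taylor Q (q i) (m i))

/-- Hermite interpolation: there are polynomials dual to the jets. -/
theorem exists_dual_jet {q : Fin d → ℂ} (hq : Function.Injective q) :
    ∃ E : Fin (∑ i, m i) → ℂ[X], ∀ Q : ℂ[X],
      pertPoly q m ∣ Q - ∑ c, jet q m (fun x => Q.eval x) c • E c := by
  set N := ∑ i, m i with hN
  let J : ℂ[X] →ₗ[ℂ] (Fin N → ℂ) := LinearMap.pi fun c =>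
    (Polynomial.lcoeff ℂ (finSigmaFinEquiv.symm c).2).comp
      (Polynomial.taylor (q (finSigmaFinEquiv.symm c).1))
  have hJ : ∀ Q c, J Q c = jet q m (fun x => Q.eval x) c := fun Q c => by
    rw [jet_polynomial]; rfl
  have hJd : ∀ Q, J Q = 0 → pertPoly q m ∣ Q := by
    intro Q h
    rw [pertPoly_dvd_iff m hq]
    intro i l hl
    have := congrFun h (finSigmaFinEquiv ⟨i, ⟨l, hl⟩⟩)
    rw [hJ, jet_polynomial, Equiv.symm_apply_apply] at this
    exact this
  let J' : Polynomial.degreeLT ℂ N →ₗ[ℂ] (Fin N → ℂ) := J.domRestrict _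
  have hinj : Function.Injective J' := by
    rw [← LinearMap.ker_eq_bot, LinearMap.ker_eq_bot']
    rintro ⟨Q, hQ⟩ h
    rw [Polynomial.mem_degreeLT] at hQ
    have h1 := Polynomial.eq_zero_of_dvd_of_degree_lt (hJd Q h) (by
      rwa [Polynomial.degree_eq_natDegree (monic_pertPoly q m).ne_zero, natDegree_pertPoly])
    exact Subtype.ext h1
  have hfin : FiniteDimensional ℂ (Polynomial.degreeLT ℂ N) :=
    Module.Finite.equiv (Polynomial.degreeLTEquiv ℂ N).symm
  have hsurj : Function.Surjective J' := by
    refine (LinearMap.injective_iff_surjective_of_finrank_eq_finrank ?_).mp hinj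
    exact (Polynomial.degreeLTEquiv ℂ N).finrank_eq
  choose g hg using hsurj
  refine ⟨fun c => (g (Pi.single c 1) : ℂ[X]), fun Q => hJd _ ?_⟩
  ext c
  have h2 : ∀ c, J (g (Pi.single c 1) : ℂ[X]) = Pi.single c 1 := fun c => hg _
  simp [h2, ← hJ, Finset.sum_apply, Pi.single_apply]

/-- The polynomial `W(y) / (y - q_i)^(a + 1)`, written without division. It has this meaning for
`a < m_i` only, as the exponent is a truncated difference. -/
noncomputable def pertQuotient (i : Fin d) (a : ℕ) : ℂ[X] :=
  (Polynomial.X - Polynomial.C (q i)) ^ (m i - 1 - a) *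
    ∏ j ∈ {i}ᶜ, (Polynomial.X - Polynomial.C (q j)) ^ m j

variable {m} in
theorem pow_mul_pertQuotient {i : Fin d} {a : ℕ} (ha : a < m i) :
    (Polynomial.X - Polynomial.C (q i)) ^ (a + 1) * pertQuotient q m i a = pertPoly q m := by
  rw [pertQuotient, ← mul_assoc, ← pow_add, show a + 1 + (m i - 1 - a) = m i by omega, pertPoly,
    Fintype.prod_eq_mul_prod_compl i]

variable {m} in
theorem degree_pertQuotient_lt {i : Fin d} {a : ℕ} (ha : a < m i) :
    (pertQuotient q m i a).degree < (∑ i, m i : ℕ) := by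
  have h := congrArg Polynomial.natDegree (pow_mul_pertQuotient q ha)
  have h0 : pertQuotient q m i a ≠ 0 := by
    intro h0
    have := pow_mul_pertQuotient q ha
    rw [h0, mul_zero] at this
    exact (monic_pertPoly q m).ne_zero this.symm
  rw [((Polynomial.monic_X_sub_C (q i)).pow _).natDegree_mul' h0, natDegree_pertPoly] at h
  rw [← Polynomial.natDegree_lt_iff_degree_lt h0]
  simp at h
  omega

variable {m} in
/-- The jets of `W(y) / (y - q_i)^(a + 1)` vanish at the other nodes; at `q_i` they are shifted
jets of `W`. -/
theorem taylor_pertQuotient_coeff {i : Fin d} {a : ℕ} (ha : a < m i) (j : Fin d) {l : ℕ}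
    (hl : l < m j) : (Polynomial.taylor (q j) (pertQuotient q m i a)).coeff l =
      if j = i then (Polynomial.taylor (q i) (pertPoly q m)).coeff (a + 1 + l) else 0 := by
  split_ifs with hji
  · subst hji
    rw [← pow_mul_pertQuotient q ha, Polynomial.taylor_mul, Polynomial.taylor_pow]
    simp only [map_sub, Polynomial.taylor_X, Polynomial.taylor_C, add_sub_cancel_right]
    rw [add_comm (a + 1) l, Polynomial.coeff_X_pow_mul]
  · refine (X_sub_C_pow_dvd_iff_taylor _ _ _).mp ?_ l hl
    exact (Finset.dvd_prod_of_mem _ (by simpa using hji)).mul_left _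

variable {q} in
/-- Every polynomial is a combination of the `W(y) / (y - q_i)^(a + 1)` modulo `W`: by Bézout, as
the polynomials `W(y) / (y - q_i)^(m_i)` have no common factor. -/
theorem exists_sub_mul_pertPoly_mem_span (hd : 0 < d) (hq : Function.Injective q)
    (Q : ℂ[X]) :
    ∃ R : ℂ[X], Q - R * pertPoly q m ∈
      Submodule.span ℂ (Set.range fun s : Σ i, Fin (m i) => pertQuotient q m s.1 s.2) := by
  have : Nonempty (Fin d) := ⟨⟨0, hd⟩⟩
  set V := Submodule.span ℂ (Set.range fun s : Σ i, Fin (m i) => pertQuotient q m s.1 s.2) with hV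
  let T : Submodule ℂ ℂ[X] := V ⊔ (Ideal.span {pertPoly q m}).restrictScalars ℂ
  suffices hT : Q ∈ T by
    obtain ⟨F, hF, G, hG, rfl⟩ := Submodule.mem_sup.mp hT
    obtain ⟨R, rfl⟩ := Ideal.mem_span_singleton'.mp hG
    exact ⟨R, by simpa using hF⟩
  -- Taylor expansion at `q i` reduces to powers of `X - q i`, the first `m i` of which give the
  -- generators and the others multiples of `W`
  have hpow : ∀ i k, (Polynomial.X - Polynomial.C (q i)) ^ k *
      ∏ j ∈ {i}ᶜ, (Polynomial.X - Polynomial.C (q j)) ^ m j ∈ T := by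
    intro i k
    by_cases hk : k < m i
    · refine Submodule.mem_sup_left (Submodule.subset_span ⟨⟨i, ⟨m i - 1 - k, by omega⟩⟩, ?_⟩)
      simp only [pertQuotient]
      rw [show m i - 1 - (m i - 1 - k) = k by omega]
    · refine Submodule.mem_sup_right (Ideal.mem_span_singleton'.mpr
        ⟨(Polynomial.X - Polynomial.C (q i)) ^ (k - m i), ?_⟩)
      rw [pertPoly, Fintype.prod_eq_mul_prod_compl i, ← mul_assoc, ← pow_add,
        Nat.sub_add_cancel (not_lt.mp hk)]
  have hmul : ∀ i (A : ℂ[X]), A *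
      ∏ j ∈ {i}ᶜ, (Polynomial.X - Polynomial.C (q j)) ^ m j ∈ T := by
    intro i A
    rw [← Polynomial.sum_taylor_eq A (q i), Polynomial.sum_def, Finset.sum_mul]
    refine Submodule.sum_mem _ fun k _ => ?_
    rw [mul_assoc, ← Polynomial.smul_eq_C_mul]
    exact Submodule.smul_mem _ _ (hpow i k)
  obtain ⟨μ, hμ⟩ := (exists_sum_eq_one_iff_pairwise_coprime'
    (s := fun i => (Polynomial.X - Polynomial.C (q i)) ^ m i)).mpr
    fun i j hij => (Polynomial.pairwise_coprime_X_sub_C hq hij).pow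
  rw [← mul_one Q, ← hμ, Finset.mul_sum]
  refine Submodule.sum_mem _ fun i _ => ?_
  rw [← mul_assoc]
  exact hmul i _

/-- The divided difference `(W(x) - W(y)) / (x - y)`, as a polynomial in `x`. -/
noncomputable def dividedDiffPoly (y : ℂ) : ℂ[X] :=
  ∑ k ∈ Finset.range (∑ i, m i + 1), Polynomial.C ((pertPoly q m).coeff k) *
    ∑ i ∈ Finset.range k, Polynomial.X ^ i * Polynomial.C y ^ (k - 1 - i)

theorem eval_dividedDiffPoly (x y : ℂ) : (dividedDiffPoly q m y).eval x = dividedDiff q m x y := by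
  simp [dividedDiffPoly, dividedDiff, Polynomial.eval_finsetSum]

theorem dividedDiffPoly_mul (y : ℂ) : dividedDiffPoly q m y * (Polynomial.X - Polynomial.C y) =
    pertPoly q m - Polynomial.C ((pertPoly q m).eval y) := by
  have h := (pertPoly q m).as_sum_range_C_mul_X_pow
  rw [natDegree_pertPoly] at h
  have h' : Polynomial.C ((pertPoly q m).eval y) = ∑ k ∈ Finset.range (∑ i, m i + 1),
      Polynomial.C ((pertPoly q m).coeff k) * Polynomial.C y ^ k := by
    rw [Polynomial.eval_eq_sum_range, natDegree_pertPoly]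
    simp
  rw [h']
  conv_rhs => enter [1]; rw [h]
  rw [dividedDiffPoly, Finset.sum_mul, ← Finset.sum_sub_distrib]
  refine Finset.sum_congr rfl fun k _ => ?_
  rw [mul_assoc, geom_sum₂_mul, mul_sub]

/-- The jets in `x` of `(W(x) - W(y)) / (x - y)` at the zeros of `W` are the polynomials
`W(y) / (y - q_i)^(a + 1)`. -/
theorem jet_dividedDiff (y : ℂ) (c : Fin (∑ i, m i)) :
    jet q m (fun x => dividedDiff q m x y) c =
      (pertQuotient q m (finSigmaFinEquiv.symm c).1 (finSigmaFinEquiv.symm c).2).eval y := by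
  simp_rw [← eval_dividedDiffPoly]
  rw [jet_polynomial]
  obtain ⟨i, ⟨a, ha⟩⟩ := finSigmaFinEquiv.symm c
  simp only
  set t := y - q i with ht
  set D := Polynomial.taylor (q i) (dividedDiffPoly q m y) with hD
  set w := (pertPoly q m).eval y with hw
  have hzero : ∀ l < m i, (Polynomial.taylor (q i) (pertPoly q m)).coeff l = 0 :=
    (X_sub_C_pow_dvd_iff_taylor _ _ _).mp (pow_dvd_pertPoly q m i)
  have hmul : D * (Polynomial.X - Polynomial.C t) =
      Polynomial.taylor (q i) (pertPoly q m) - Polynomial.C w := by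
    have h := congrArg (Polynomial.taylor (q i)) (dividedDiffPoly_mul q m y)
    rw [Polynomial.taylor_mul] at h
    simp only [map_sub, Polynomial.taylor_X, Polynomial.taylor_C] at h
    rw [← h, ht]
    simp only [map_sub]
    ring
  have h0 : D.coeff 0 * t = w := by
    have h := congrArg (fun p => p.coeff 0) hmul
    simp only [mul_sub, Polynomial.coeff_sub, Polynomial.coeff_C_zero,
      Polynomial.mul_coeff_zero, Polynomial.coeff_X_zero, hzero 0 (by omega)] at h
    linear_combination -h
  have hs : ∀ l, D.coeff l = D.coeff (l + 1) * t +
      (Polynomial.taylor (q i) (pertPoly q m)).coeff (l + 1) := by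
    intro l
    have h := congrArg (fun p => p.coeff (l + 1)) hmul
    simp only [mul_sub, Polynomial.coeff_sub, Polynomial.coeff_mul_C, Polynomial.coeff_C_succ,
      Polynomial.coeff_mul_X] at h
    linear_combination h
  -- the recurrence gives `t ^ (a + 1) * D.coeff a = W(y)`, which determines `D.coeff a` unless `y`
  -- is the node itself
  by_cases ht0 : t = 0
  · have hy : y = q i := sub_eq_zero.mp ht0
    rw [hs, ht0, mul_zero, zero_add, hy, ← Polynomial.taylor_coeff_zero,
      taylor_pertQuotient_coeff q ha i (by omega), if_pos rfl, add_zero]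
  · have h1 : ∀ l < m i, t ^ (l + 1) * D.coeff l = w := by
      intro l
      induction l with
      | zero => intro _; rw [← h0]; ring
      | succ l ih =>
        intro hl
        rw [← ih (by omega), hs l, hzero _ hl]
        ring
    have h2 := congrArg (fun p => p.eval y) (pow_mul_pertQuotient q ha)
    simp only [Polynomial.eval_mul, Polynomial.eval_pow, Polynomial.eval_sub, Polynomial.eval_X,
      Polynomial.eval_C] at h2
    exact mul_left_cancel₀ (pow_ne_zero (a + 1) ht0) ((h1 a ha).trans h2.symm)

end Perturbation

section Perturbation

variable {d : ℕ} {q : Fin d → ℂ} {m : Fin d → ℕ}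

/-! ### Geronimus transformations and their masses -/

/-- Masses come from Hermite interpolation, applied to `v - u / W`, which vanishes on the multiples
of `W`. -/
theorem isGeronimus_iff_exists_hasMasses (u : GeneralizedKernel) (hq : Function.Injective q)
    (hsupp : ∀ i, q i ∉ u.suppY) (v : LinearMap.BilinForm ℂ ℂ[X]) :
    IsGeronimus q m u v ↔
      ∃ ξ : (i : Fin d) → Fin (m i) → ℂ[X] →ₗ[ℂ] ℂ, HasMasses q u ξ v := by
  constructor
  · intro hG
    obtain ⟨V, hV⟩ := u.exists_pair_div_pertPoly q m hsupp
    let L : LinearMap.BilinForm ℂ ℂ[X] :=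
      ((LinearMap.mul ℂ slowlyIncreasing).compl₁₂ (Polynomial.aeval coordX).toLinearMap
        (Polynomial.aeval coordY).toLinearMap).compr₂ (u.toFun.comp (LinearMap.mulRight ℂ V))
    have hL : ∀ P Q, L P Q = u.pair P (fun y => Q.eval y / (pertPoly q m).eval y) :=
      fun P Q => (hV P Q).symm
    obtain ⟨E, hE⟩ := exists_dual_jet m hq
    refine ⟨fun i l => (v - L).flip (E (finSigmaFinEquiv ⟨i, l⟩)), fun P Q => ?_⟩
    obtain ⟨R, hR⟩ := hE Q
    have h0 : (v - L) P (Q - ∑ c, jet q m (fun x => Q.eval x) c • E c) = 0 := by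
      rw [hR, mul_comm, LinearMap.sub_apply, LinearMap.sub_apply, hL,
        u.pair_mul_pertPoly_div q m hsupp, hG P R, sub_self]
    rw [map_sub, sub_eq_zero, map_sum, ← finSigmaFinEquiv.sum_comp, Fintype.sum_sigma,
      LinearMap.sub_apply, LinearMap.sub_apply, hL, sub_eq_iff_eq_add'] at h0
    rw [h0]
    congr 1
    refine Finset.sum_congr rfl fun i _ => Finset.sum_congr rfl fun l _ => ?_
    rw [map_smul, smul_eq_mul, jet_polynomial, Equiv.symm_apply_apply,
      eval_iterate_derivative_div_factorial, mul_comm]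
    rfl
  · rintro ⟨ξ, hξ⟩ P Q
    rw [hξ, u.pair_mul_pertPoly_div q m hsupp, add_eq_left]
    refine Finset.sum_eq_zero fun i _ => Finset.sum_eq_zero fun l _ => ?_
    rw [eval_iterate_derivative_div_factorial,
      (pertPoly_dvd_iff m hq _).mp (dvd_mul_left _ _) i l l.2, mul_zero]

theorem vecMul_massRow_massMatrix (ξ : (i : Fin d) → Fin (m i) → ℂ[X] →ₗ[ℂ] ℂ) (P : ℂ[X])
    (c : Fin (∑ i, m i)) :
    Matrix.vecMul (massRow ξ P) (massMatrix q m) c =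
      ∑ l : Fin (m (finSigmaFinEquiv.symm c).1), ξ _ l P *
        (Polynomial.taylor (q (finSigmaFinEquiv.symm c).1) (pertPoly q m)).coeff
          ((finSigmaFinEquiv.symm c).2 + 1 + l) := by
  simp only [Matrix.vecMul, dotProduct, massRow, massMatrix, Matrix.of_apply]
  obtain ⟨i, b⟩ := finSigmaFinEquiv.symm c
  rw [finSigmaFinEquiv.symm.sum_comp (fun s : Σ i, Fin (m i) => ξ s.1 s.2.rev P *
    if s.1 = i then (Polynomial.derivative^[m s.1 + b - s.2] (pertPoly q m)).eval (q s.1) /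
      ((m s.1 + b - s.2) ! : ℂ) else 0), Fintype.sum_sigma]
  rw [Finset.sum_eq_single i]
  · simp only [if_true]
    rw [← Equiv.sum_comp Fin.revPerm]
    refine Finset.sum_congr rfl fun l _ => ?_
    rw [eval_iterate_derivative_div_factorial, Fin.revPerm_apply, Fin.rev_rev, Fin.val_rev]
    congr 2
    omega
  · intro j _ hj
    simp [hj]
  · simp

/-- The rows of the quasi-determinants are, up to sign, the values of the perturbed form at the
polynomials `W(y) / (y - q_i)^(a + 1)`: the integral part gives the jets of the second kind
function, and the masses see shifted jets of `W`. -/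
theorem jet_secondKind_sub_massRow (u : GeneralizedKernel) (hsupp : ∀ i, q i ∉ u.suppY)
    {ξ : (i : Fin d) → Fin (m i) → ℂ[X] →ₗ[ℂ] ℂ} {v : LinearMap.BilinForm ℂ ℂ[X]}
    (hξ : HasMasses q u ξ v) (P : ℂ[X]) (c : Fin (∑ i, m i)) :
    jet q m (u.secondKind P) c - Matrix.vecMul (massRow ξ P) (massMatrix q m) c =
      -v P (pertQuotient q m (finSigmaFinEquiv.symm c).1 (finSigmaFinEquiv.symm c).2) := by
  rw [vecMul_massRow_massMatrix, hξ, jet]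
  obtain ⟨i, ⟨a, ha⟩⟩ := finSigmaFinEquiv.symm c
  simp only
  rw [u.iteratedDeriv_secondKind (hsupp i) P (GeneralizedKernel.isCompact_range_nodes q)
    (GeneralizedKernel.disjoint_range_nodes q u hsupp) a
    (R := fun y => (pertQuotient q m i a).eval y / (pertPoly q m).eval y), neg_add',
    sub_right_inj, Finset.sum_eq_single i]
  · refine Finset.sum_congr rfl fun l _ => ?_
    rw [eval_iterate_derivative_div_factorial, taylor_pertQuotient_coeff q ha i l.2, if_pos rfl]
  · intro j _ hj
    refine Finset.sum_eq_zero fun l _ => ?_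
    rw [eval_iterate_derivative_div_factorial, taylor_pertQuotient_coeff q ha j l.2, if_neg hj,
      mul_zero]
  · simp
  · intro y hy
    have h1 := GeneralizedKernel.eval_pertPoly_ne_zero q m hy
    have h2 := congrArg (fun p => p.eval y) (pow_mul_pertQuotient q ha)
    simp only [Polynomial.eval_mul, Polynomial.eval_pow, Polynomial.eval_sub, Polynomial.eval_X,
      Polynomial.eval_C] at h2
    rw [← h2] at h1 ⊢
    have h3 := right_ne_zero_of_mul h1
    rw [div_mul_cancel_right₀ h3]

theorem corrRow_apply (u : GeneralizedKernel) (hsupp : ∀ i, q i ∉ u.suppY)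
    {ξ : (i : Fin d) → Fin (m i) → ℂ[X] →ₗ[ℂ] ℂ} {v : LinearMap.BilinForm ℂ ℂ[X]}
    (hξ : HasMasses q u ξ v) (S₁ : Matrix ℕ ℕ ℂ) (k : ℕ) (c : Fin (∑ i, m i)) :
    corrRow q u ξ S₁ k c = -v (polyOf S₁ k)
      (pertQuotient q m (finSigmaFinEquiv.symm c).1 (finSigmaFinEquiv.symm c).2) :=
  jet_secondKind_sub_massRow u hsupp hξ (polyOf S₁ k) c

theorem jet_mixedKernel (u : GeneralizedKernel) (hsupp : ∀ i, q i ∉ u.suppY)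
    (S₁ S₂ : Matrix ℕ ℕ ℂ) (H : ℕ → ℂ) (n : ℕ) (y : ℂ) (c : Fin (∑ i, m i)) :
    jet q m (fun x => mixedKernel u S₁ S₂ H n x y) c =
      ∑ k ∈ Finset.range n, (polyOf S₂ k).eval y * (H k)⁻¹ *
        jet q m (u.secondKind (polyOf S₁ k)) c := by
  simp only [jet, mixedKernel]
  rw [iteratedDeriv_fun_sum fun k _ => contDiffAt_const.mul
    (u.analyticAt_secondKind (hsupp _) (polyOf S₁ k)).contDiffAt, Finset.sum_div]
  refine Finset.sum_congr rfl fun k _ => ?_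
  rw [iteratedDeriv_const_mul_field, mul_div_assoc]

/-- The last row of the third quasi-determinant: `E(y) - W(y) v(K_{n-1}(·, y), E)`, where `E` runs
through the `W(y) / (y - q_i)^(a + 1)`. -/
theorem kernelRow_apply (u : GeneralizedKernel) (hsupp : ∀ i, q i ∉ u.suppY)
    {ξ : (i : Fin d) → Fin (m i) → ℂ[X] →ₗ[ℂ] ℂ} {v : LinearMap.BilinForm ℂ ℂ[X]}
    (hξ : HasMasses q u ξ v) (S₁ S₂ : Matrix ℕ ℕ ℂ) (H : ℕ → ℂ) (n : ℕ) (y : ℂ)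
    (c : Fin (∑ i, m i)) :
    kernelRow q u ξ S₁ S₂ H n y c =
      (pertQuotient q m (finSigmaFinEquiv.symm c).1 (finSigmaFinEquiv.symm c).2).eval y -
      (pertPoly q m).eval y * v (cdKernel S₁ S₂ H n y)
        (pertQuotient q m (finSigmaFinEquiv.symm c).1 (finSigmaFinEquiv.symm c).2) := by
  have hv : v (cdKernel S₁ S₂ H n y)
      (pertQuotient q m (finSigmaFinEquiv.symm c).1 (finSigmaFinEquiv.symm c).2) =
      ∑ k ∈ Finset.range n, (polyOf S₂ k).eval y * (H k)⁻¹ * v (polyOf S₁ k)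
        (pertQuotient q m (finSigmaFinEquiv.symm c).1 (finSigmaFinEquiv.symm c).2) := by
    simp only [cdKernel, ← Polynomial.smul_eq_C_mul, map_sum, LinearMap.sum_apply, map_smul,
      LinearMap.smul_apply, smul_eq_mul]
  have hm : Matrix.vecMul (massRow ξ (cdKernel S₁ S₂ H n y)) (massMatrix q m) c =
      ∑ k ∈ Finset.range n, (polyOf S₂ k).eval y * (H k)⁻¹ *
        Matrix.vecMul (massRow ξ (polyOf S₁ k)) (massMatrix q m) c := by
    simp only [vecMul_massRow_massMatrix, cdKernel, ← Polynomial.smul_eq_C_mul, map_sum, map_smul,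
      smul_eq_mul, Finset.sum_mul, Finset.mul_sum]
    rw [Finset.sum_comm]
    exact Finset.sum_congr rfl fun k _ => Finset.sum_congr rfl fun l _ => by ring
  simp only [kernelRow, Pi.add_apply, Pi.smul_apply, Pi.sub_apply, smul_eq_mul]
  rw [jet_mixedKernel u hsupp, hm, jet_dividedDiff, hv, ← Finset.sum_sub_distrib,
    Finset.sum_congr rfl fun k _ => by rw [← mul_sub, jet_secondKind_sub_massRow u hsupp hξ]]
  simp only [mul_neg, Finset.sum_neg_distrib]
  ring

/-! ### The perturbed biorthogonal polynomials -/

/-- The connection between the two families: a polynomial orthogonal for `v` to small degrees is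
orthogonal for `u` to degrees smaller by `deg W`. -/
theorem IsGeronimus.form_eq_zero {u : GeneralizedKernel} {v : LinearMap.BilinForm ℂ ℂ[X]}
    (hG : IsGeronimus q m u v) {s : ℕ} {P : ℂ[X]}
    (hP : ∀ Q : ℂ[X], Q.degree < (s + ∑ i, m i : ℕ) → v P Q = 0) (Q : ℂ[X]) (hQ : Q.degree < s) :
    u.form P Q = 0 := by
  rw [← hG P Q]
  refine hP _ ?_
  rw [(monic_pertPoly q m).degree_mul, Polynomial.degree_eq_natDegree (monic_pertPoly q m).ne_zero,
    natDegree_pertPoly, Nat.cast_add]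
  exact WithBot.add_lt_add_right (by exact WithBot.coe_ne_bot) hQ

/-- A polynomial annihilated by `v` against all the `W(y) / (y - q_i)^(a + 1)` and orthogonal for `u`
to small degrees is orthogonal for `v` to degrees larger by `deg W`. -/
theorem IsGeronimus.apply_eq_zero {u : GeneralizedKernel} {v : LinearMap.BilinForm ℂ ℂ[X]}
    (hG : IsGeronimus q m u v) (hd : 0 < d) (hq : Function.Injective q) {s : ℕ} {P : ℂ[X]}
    (hP : ∀ Q : ℂ[X], Q.degree < s → u.form P Q = 0)
    (hE : ∀ (i : Fin d) (a : Fin (m i)), v P (pertQuotient q m i a) = 0) (Q : ℂ[X])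
    (hQ : Q.degree < (s + ∑ i, m i : ℕ)) : v P Q = 0 := by
  obtain ⟨R, hR⟩ := exists_sub_mul_pertPoly_mem_span m hd hq Q
  have h1 : Submodule.span ℂ (Set.range fun s : Σ i, Fin (m i) => pertQuotient q m s.1 s.2) ≤
      LinearMap.ker (v P) := by
    rw [Submodule.span_le]
    rintro _ ⟨⟨i, a⟩, rfl⟩
    exact hE i a
  have h2 : Submodule.span ℂ (Set.range fun s : Σ i, Fin (m i) => pertQuotient q m s.1 s.2) ≤
      Polynomial.degreeLT ℂ (s + ∑ i, m i) := by
    rw [Submodule.span_le]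
    rintro _ ⟨⟨i, a⟩, rfl⟩
    refine Polynomial.mem_degreeLT.mpr ((degree_pertQuotient_lt q a.2).trans_le ?_)
    exact_mod_cast Nat.le_add_left _ _
  have h3 : v P (Q - R * pertPoly q m) = 0 := h1 hR
  have h4 : (R * pertPoly q m).degree < (s + ∑ i, m i : ℕ) := by
    have := Submodule.sub_mem _ (Polynomial.mem_degreeLT.mpr hQ) (h2 hR)
    rwa [sub_sub_cancel, Polynomial.mem_degreeLT] at this
  rw [(monic_pertPoly q m).degree_mul, Polynomial.degree_eq_natDegree (monic_pertPoly q m).ne_zero,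
    natDegree_pertPoly, Nat.cast_add] at h4
  have h5 := hP R (lt_of_add_lt_add_right h4)
  rw [map_sub, hG P R, h5, sub_zero] at h3
  exact h3

/-- A vanishing combination of the rows gives a polynomial of degree less than `s + deg W` which is
orthogonal for `v` to all such polynomials. -/
theorem isUnit_det_corrRow {u : GeneralizedKernel} (hd : 0 < d) (hq : Function.Injective q)
    (hsupp : ∀ i, q i ∉ u.suppY) {ξ : (i : Fin d) → Fin (m i) → ℂ[X] →ₗ[ℂ] ℂ}
    {v : LinearMap.BilinForm ℂ ℂ[X]} (hξ : HasMasses q u ξ v) (hv : QuasiDefinite v)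
    {S₁ S₂ : Matrix ℕ ℕ ℂ} {H : ℕ → ℂ} (hS : IsGaussBorel u.form S₁ S₂ H) (s : ℕ) :
    IsUnit (Matrix.of fun r : Fin (∑ i, m i) => corrRow q u ξ S₁ (s + r)).det := by
  have hG := (isGeronimus_iff_exists_hasMasses u hq hsupp v).mpr ⟨ξ, hξ⟩
  rw [isUnit_iff_ne_zero]
  intro h0
  obtain ⟨a, ha0, ha⟩ := Matrix.exists_vecMul_eq_zero_iff.mpr h0
  set P : ℂ[X] := ∑ r, a r • polyOf S₁ (s + r) with hP
  have hE : ∀ (i : Fin d) (b : Fin (m i)), v P (pertQuotient q m i b) = 0 := by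
    intro i b
    have h1 := congrFun ha (finSigmaFinEquiv ⟨i, b⟩)
    simp only [Matrix.vecMul, dotProduct, Matrix.of_apply, corrRow_apply u hsupp hξ,
      Pi.zero_apply, mul_neg, Finset.sum_neg_distrib, neg_eq_zero] at h1
    rw [Equiv.symm_apply_apply] at h1
    simpa [hP] using h1
  have hu : ∀ Q : ℂ[X], Q.degree < s → u.form P Q = 0 := by
    intro Q hQ
    simp only [hP, map_sum, LinearMap.sum_apply, map_smul, LinearMap.smul_apply]
    refine Finset.sum_eq_zero fun r _ => ?_
    rw [hS.apply_eq_zero (hQ.trans_le (by exact_mod_cast Nat.le_add_right _ _)), smul_zero]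
  have hdeg : P.degree < (s + ∑ i, m i : ℕ) := by
    rw [← Polynomial.mem_degreeLT]
    refine Submodule.sum_mem _ fun r _ => Submodule.smul_mem _ _ ?_
    rw [Polynomial.mem_degreeLT, hS.lower₁.degree_polyOf]
    exact_mod_cast Nat.add_lt_add_left r.2 s
  have hP0 : P = 0 := hv.eq_zero hdeg (hG.apply_eq_zero hd hq hu hE)
  refine ha0 (funext fun r => ?_)
  let p : Polynomial.Sequence ℂ := ⟨polyOf S₁, hS.lower₁.degree_polyOf⟩
  have hli : LinearIndependent ℂ (fun r : Fin (∑ i, m i) => polyOf S₁ (s + r)) :=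
    p.linearIndependent.comp (fun r : Fin (∑ i, m i) => s + (r : ℕ))
      fun _ _ h => Fin.ext (Nat.add_left_cancel h)
  exact Fintype.linearIndependent_iff.mp hli a hP0 r
theorem IsGaussBorel.apply_sum_polyOf_first {B : LinearMap.BilinForm ℂ ℂ[X]}
    {S₁ S₂ : Matrix ℕ ℕ ℂ} {H : ℕ → ℂ} (h : IsGaussBorel B S₁ S₂ H) {N : ℕ} (c : Fin N → ℂ)
    (s : ℕ) : B (∑ r, c r • polyOf S₁ (s + r)) (polyOf S₂ s) =
      ∑ r, c r * if (r : ℕ) = 0 then H s else 0 := by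
  simp only [map_sum, LinearMap.sum_apply, map_smul, LinearMap.smul_apply, smul_eq_mul,
    h.apply_polyOf, Nat.add_eq_left]
  refine Finset.sum_congr rfl fun r _ => ?_
  split_ifs with hr
  · rw [hr, add_zero]
  · rfl

theorem monic_polyOf_mul_pertPoly {S : Matrix ℕ ℕ ℂ} (hS : LowerUnitriangular S) (s : ℕ) :
    (polyOf S s * pertPoly q m).Monic :=
  (hS.monic_polyOf s).mul (monic_pertPoly q m)

theorem natDegree_polyOf_mul_pertPoly {S : Matrix ℕ ℕ ℂ} (hS : LowerUnitriangular S) (s : ℕ) :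
    (polyOf S s * pertPoly q m).natDegree = s + ∑ i, m i := by
  rw [(hS.monic_polyOf s).natDegree_mul (monic_pertPoly q m), hS.natDegree_polyOf,
    natDegree_pertPoly]

variable {u : GeneralizedKernel} (hsupp : ∀ i, q i ∉ u.suppY)
  {ξ : (i : Fin d) → Fin (m i) → ℂ[X] →ₗ[ℂ] ℂ} {v : LinearMap.BilinForm ℂ ℂ[X]}
  (hξ : HasMasses q u ξ v) (hG : IsGeronimus q m u v) (hu : QuasiDefinite u.form)
  {S₁ S₂ : Matrix ℕ ℕ ℂ} {H : ℕ → ℂ} (hS : IsGaussBorel u.form S₁ S₂ H)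
  {T₁ T₂ : Matrix ℕ ℕ ℂ} {H' : ℕ → ℂ} (hT : IsGaussBorel v T₁ T₂ H')

include hsupp hξ hG hu hS hT in
/-- The connection formula for the first family. Its coefficients are determined by the rows
`corrRow`, since the perturbed polynomial is orthogonal for `v` to all the
`W(y) / (y - q_i)^(a + 1)`. -/
theorem exists_connection_first (hN : 0 < ∑ i, m i) (s : ℕ) :
    ∃ c : Fin (∑ i, m i) → ℂ,
      polyOf T₁ (s + ∑ i, m i) = polyOf S₁ (s + ∑ i, m i) + ∑ r, c r • polyOf S₁ (s + r) ∧
      (∀ e, corrRow q u ξ S₁ (s + ∑ i, m i) e = ∑ r, -c r * corrRow q u ξ S₁ (s + r) e) ∧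
      H' (s + ∑ i, m i) = ∑ r, c r * if (r : ℕ) = 0 then H s else 0 := by
  set n := s + ∑ i, m i with hn
  have hsn : (s : WithBot ℕ) < n := by exact_mod_cast (by omega : s < n)
  have hdeg : (polyOf T₁ n - polyOf S₁ n).degree < n :=
    hS.lower₁.degree_sub_polyOf_lt (hT.lower₁.monic_polyOf n) (hT.lower₁.natDegree_polyOf n)
  have hort : ∀ Q : ℂ[X], Q.degree < s → u.form (polyOf T₁ n - polyOf S₁ n) Q = 0 := by
    intro Q hQ
    rw [map_sub, LinearMap.sub_apply, hS.apply_eq_zero (hQ.trans hsn), sub_zero]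
    exact hG.form_eq_zero (fun Q hQ => hT.apply_eq_zero hQ) Q hQ
  obtain ⟨c, hc⟩ := hS.exists_eq_sum_of_orthogonal hu hdeg hort
  refine ⟨c, by rw [← hc]; ring, fun e => ?_, ?_⟩
  · set E := pertQuotient q m (finSigmaFinEquiv.symm e).1 (finSigmaFinEquiv.symm e).2 with hE
    have h1 : v (polyOf T₁ n) E = 0 := hT.apply_eq_zero
      ((degree_pertQuotient_lt q (finSigmaFinEquiv.symm e).2.2).trans_le
        (by exact_mod_cast Nat.le_add_left _ _))
    have h2 := congrArg (fun P => v P E) hc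
    simp only [map_sub, LinearMap.sub_apply, h1, map_sum, LinearMap.sum_apply, map_smul,
      LinearMap.smul_apply, smul_eq_mul, zero_sub] at h2
    simp only [corrRow_apply u hsupp hξ, ← hE, neg_mul_neg]
    exact h2
  · rw [← hS.apply_sum_polyOf_first, ← hc, map_sub, LinearMap.sub_apply,
      hS.apply_eq_zero (by rwa [hS.lower₂.degree_polyOf]), sub_zero, ← hG]
    exact (hT.apply_monic (monic_polyOf_mul_pertPoly hS.lower₂ s)
      (natDegree_polyOf_mul_pertPoly hS.lower₂ s)).symm

include hsupp hξ hG hu hS hT in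
/-- The connection formula for the second family, through the difference of the two
Christoffel--Darboux kernels `W(y) K_{n-1}(x, y) - Ǩ_{n-1}(x, y)`: by the reproducing properties it
involves only the last `N = deg W` polynomials of the first family. -/
theorem exists_connection_second (hv : QuasiDefinite v) (hN : 0 < ∑ i, m i) (s : ℕ) (y : ℂ) :
    ∃ c : Fin (∑ i, m i) → ℂ,
      (∀ e, kernelRow q u ξ S₁ S₂ H (s + ∑ i, m i) y e =
        ∑ r, c r * corrRow q u ξ S₁ (s + r) e) ∧
      (polyOf T₂ (s + ∑ i, m i)).eval y = ∑ r, c r * if (r : ℕ) = 0 then H s else 0 := by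
  set n := s + ∑ i, m i with hn
  have hsn : (s : WithBot ℕ) < n := by exact_mod_cast (by omega : s < n)
  set w := (pertPoly q m).eval y with hw
  set R : ℂ[X] := w • cdKernel S₁ S₂ H n y - cdKernel T₁ T₂ H' n y with hR
  have hform : ∀ Q : ℂ[X], Q.degree < n →
      u.form R Q = w * Q.eval y - v (cdKernel T₁ T₂ H' n y) (Q * pertPoly q m) := by
    intro Q hQ
    rw [hR, map_sub, LinearMap.sub_apply, map_smul, LinearMap.smul_apply, hS.apply_cdKernel hu hQ,
      hG, smul_eq_mul]
  have hdeg : R.degree < n := by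
    rw [← Polynomial.mem_degreeLT]
    exact Submodule.sub_mem _
      (Submodule.smul_mem _ _ (Polynomial.mem_degreeLT.mpr (hS.degree_cdKernel_lt n y)))
      (Polynomial.mem_degreeLT.mpr (hT.degree_cdKernel_lt n y))
  have hort : ∀ Q : ℂ[X], Q.degree < s → u.form R Q = 0 := by
    intro Q hQ
    have hQW : (Q * pertPoly q m).degree < n := by
      rw [(monic_pertPoly q m).degree_mul,
        Polynomial.degree_eq_natDegree (monic_pertPoly q m).ne_zero, natDegree_pertPoly, hn,
        Nat.cast_add]
      exact WithBot.add_lt_add_right (by exact WithBot.coe_ne_bot) hQ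
    rw [hform Q (hQ.trans hsn), hT.apply_cdKernel hv hQW, Polynomial.eval_mul, mul_comm, sub_self]
  obtain ⟨c, hc⟩ := hS.exists_eq_sum_of_orthogonal hu hdeg hort
  refine ⟨c, fun e => ?_, ?_⟩
  · rw [kernelRow_apply u hsupp hξ]
    simp only [corrRow_apply u hsupp hξ]
    set E := pertQuotient q m (finSigmaFinEquiv.symm e).1 (finSigmaFinEquiv.symm e).2 with hE
    have h1 : v (cdKernel T₁ T₂ H' n y) E = E.eval y := hT.apply_cdKernel hv
      ((degree_pertQuotient_lt q (finSigmaFinEquiv.symm e).2.2).trans_le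
        (by exact_mod_cast Nat.le_add_left _ _)) y
    have h2 := congrArg (fun P => v P E) hc
    simp only [hR, map_sub, LinearMap.sub_apply, h1, map_sum, LinearMap.sum_apply, map_smul,
      LinearMap.smul_apply, smul_eq_mul] at h2
    simp only [mul_neg, Finset.sum_neg_distrib]
    rw [← h2]
    ring
  · have h1 := hT.apply_cdKernel hv (hT.lower₂.degree_sub_polyOf_lt
      (monic_polyOf_mul_pertPoly (q := q) (m := m) hS.lower₂ s)
      (natDegree_polyOf_mul_pertPoly hS.lower₂ s)) y
    rw [map_sub, hT.apply_cdKernel_polyOf, sub_zero] at h1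
    rw [← hS.apply_sum_polyOf_first, ← hc, hform _ (by rwa [hS.lower₂.degree_polyOf]), h1,
      Polynomial.eval_sub, Polynomial.eval_mul]
    ring

end Perturbation

theorem mainTheorem2 (u : GeneralizedKernel)
    {d : ℕ} (hd : 0 < d) (q : Fin d → ℂ) (hq : Function.Injective q)
    (m : Fin d → ℕ) (hm : ∀ i, 0 < m i) (hsupp : ∀ i, q i ∉ u.suppY)
    (v : LinearMap.BilinForm ℂ ℂ[X])
    (hu : QuasiDefinite u.form) (hv : QuasiDefinite v)
    (S₁ S₂ : Matrix ℕ ℕ ℂ) (H : ℕ → ℂ) (hS : IsGaussBorel u.form S₁ S₂ H)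
    (T₁ T₂ : Matrix ℕ ℕ ℂ) (H' : ℕ → ℂ) (hT : IsGaussBorel v T₁ T₂ H') :
    -- the Geronimus transformations of `u` are the `v = u / W + masses`, with free functionals
    (IsGeronimus q m u v ↔
      ∃ ξ : (i : Fin d) → Fin (m i) → ℂ[X] →ₗ[ℂ] ℂ, HasMasses q u ξ v) ∧
    -- the jets of the second kind functions make sense
    (∀ k i, AnalyticAt ℂ (u.secondKind (polyOf S₁ k)) (q i)) ∧
    ∀ ξ : (i : Fin d) → Fin (m i) → ℂ[X] →ₗ[ℂ] ℂ, HasMasses q u ξ v →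
      ∀ N n : ℕ, N = ∑ i, m i → N ≤ n →
        -- the block that the three quasi-determinants invert is nonsingular
        IsUnit (Matrix.of fun r : Fin (∑ i, m i) => corrRow q u ξ S₁ (n - N + r)).det ∧
        (∀ x : ℂ, (polyOf T₁ n).eval x =
          thetaStar (Matrix.of fun r : Fin (∑ i, m i + 1) =>
            (Fin.snoc (corrRow q u ξ S₁ (n - N + r)) ((polyOf S₁ (n - N + r)).eval x) :
              Fin (∑ i, m i + 1) → ℂ))) ∧
        H' n =
          thetaStar (Matrix.of fun r : Fin (∑ i, m i + 1) =>
            (Fin.snoc (corrRow q u ξ S₁ (n - N + r)) (if (r : ℕ) = 0 then H (n - N) else 0) :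
              Fin (∑ i, m i + 1) → ℂ)) ∧
        (∀ y : ℂ, (polyOf T₂ n).eval y =
          -thetaStar (Matrix.of (Fin.snoc
            (fun r : Fin (∑ i, m i) =>
              (Fin.snoc (corrRow q u ξ S₁ (n - N + r)) (if (r : ℕ) = 0 then H (n - N) else 0) :
                Fin (∑ i, m i + 1) → ℂ))
            (Fin.snoc (kernelRow q u ξ S₁ S₂ H n y) 0 : Fin (∑ i, m i + 1) → ℂ) :
              Fin (∑ i, m i + 1) → Fin (∑ i, m i + 1) → ℂ))) := by
  have hN : 0 < ∑ i, m i := (hm ⟨0, hd⟩).trans_le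
    (Finset.single_le_sum (fun i _ => Nat.zero_le (m i)) (Finset.mem_univ _))
  refine ⟨isGeronimus_iff_exists_hasMasses u hq hsupp v,
    fun k i => u.analyticAt_secondKind (hsupp i) _, fun ξ hξ N n hNm hn => ?_⟩
  have hG := (isGeronimus_iff_exists_hasMasses u hq hsupp v).mpr ⟨ξ, hξ⟩
  obtain ⟨s, rfl⟩ := Nat.exists_eq_add_of_le' hn
  subst hNm
  simp only [Nat.add_sub_cancel]
  have hdet := isUnit_det_corrRow hd hq hsupp hξ hv hS s
  -- each quasi-determinant is read off from the relation that expresses its last row by the others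
  obtain ⟨c, hc, hrow, hH⟩ := exists_connection_first hsupp hξ hG hu hS hT hN s
  refine ⟨hdet, fun x => ?_, ?_, fun y => ?_⟩
  · rw [thetaStar_of_vecMul_eq _ ?_ (fun r => -c r) ?_]
    · simp [hc, Polynomial.eval_finsetSum]
    · convert! hdet using 2
      ext r e
      simp
    · intro e
      simpa using hrow e
  · rw [thetaStar_of_vecMul_eq _ ?_ (fun r => -c r) ?_]
    · simp only [Matrix.of_apply, Fin.snoc_last, Fin.val_last, hN.ne', if_false, Fin.val_castSucc,
        neg_mul, Finset.sum_neg_distrib, zero_sub, neg_neg, hH]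
    · convert! hdet using 2
      ext r e
      simp
    · intro e
      simpa using hrow e
  · obtain ⟨b, hb, hy⟩ := exists_connection_second hsupp hξ hG hu hS hT hv hN s y
    rw [thetaStar_of_vecMul_eq _ ?_ b ?_]
    · simp [hy]
    · convert! hdet using 2
      ext r e
      simp
    · intro e
      simpa using hb e
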